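/- An environment is a family $\omega=\{\omega(x)\}_{x\in\mathbb Z}$ with $\omega(x)\in[\frac12,1)$ for all $x$. Given $\omega$ and $y\in\mathbb Z$, let $P^\omega_y$ be the law of the nearest-neighbour random walk $\{X_n\}_{n\ge0}$ on $\mathbb Z$ with $X_0=y$ such that, conditionally on $X_0,\dots,X_n$, one has $X_{n+1}=X_n+1$ with probability $p_n$ and $X_{n+1}=X_n-1$ with probability $1-p_n$, where $p_n=\frac12$ if the walk has already jumped to the left from its current site (that is, $X_k=X_n$ and $X_{k+1}=X_n-1$ for some $k<n$) and $p_n=\omega(X_n)$ otherwise. The walk in the environment $\omega$ is called recurrent if $P^\omega_y(X_n=x \text{ for infinitely many } n)=1$ for all $x,y\in\mathbb Z$, and transient if this probability is $0$ for all $x,y\in\mathbb Z$. Theorem. Let $\mathcal P^S$ be a probability measure on $[\frac12,1)^{\mathbb Z}$ that is stationary and ergodic under the shift $(\theta\omega)(z)=\omega(z+1)$, and let $\mathcal E^S$ be its expectation, so that $\mathcal E^S\big[\frac{\omega(0)}{1-\omega(0)}\big]\in[1,\infty]$. (i) If $\mathcal E^S\big[\frac{\omega(0)}{1-\omega(0)}\big]\le2$,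 then for $\mathcal P^S$-almost every $\omega$ the walk in the environment $\omega$ is recurrent. (ii) If $\mathcal E^S\big[\frac{\omega(0)}{1-\omega(0)}\big]>2$ (possibly $+\infty$), then for $\mathcal P^S$-almost every $\omega$ the walk in the environment $\omega$ is transient. -/

import Mathlib

open MeasureTheory ProbabilityTheory Filter

namespace CookieWalk

/-- An environment assigns to every site `x : ℤ` a cookie strength `ω x ∈ [1/2, 1)`. The space of
environments carries the product (cylinder) σ-algebra. -/
abbrev Environment : Type := ℤ → Set.Ico (1 / 2 : ℝ) 1

/-- The spatial shift `(θ ω)(z) = ω (z + 1)`. -/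
def shift (ω : Environment) : Environment := fun z => ω (z + 1)

/-- Given the positions `h 0, …, h n` up to time `n`, the cookie at site `x` has been consumed if
the walk has already made a jump from `x` to `x - 1`. -/
def Consumed {n : ℕ} (h : Finset.Iic n → ℤ) (x : ℤ) : Prop :=
  ∃ (k : ℕ) (hk : k < n), h ⟨k, Finset.mem_Iic.2 hk.le⟩ = x ∧
    h ⟨k + 1, Finset.mem_Iic.2 hk⟩ = x - 1

/-- The current position, after the positions up to time `n` have been recorded. -/
def current {n : ℕ} (h : Finset.Iic n → ℤ) : ℤ := h ⟨n, Finset.mem_Iic.2 le_rfl⟩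

open Classical in
/-- The conditional probability of jumping to the right, given the positions up to time `n`. -/
noncomputable def rightProb (ω : Environment) {n : ℕ} (h : Finset.Iic n → ℤ) : ℝ :=
  if Consumed h (current h) then 1 / 2 else (ω (current h) : ℝ)

/-- The conditional law of the position at time `n + 1`, given the positions up to time `n`. -/
noncomputable def stepMeasure (ω : Environment) {n : ℕ} (h : Finset.Iic n → ℤ) : Measure ℤ :=
  ENNReal.ofReal (rightProb ω h) • Measure.dirac (current h + 1) +
    ENNReal.ofReal (1 - rightProb ω h) • Measure.dirac (current h - 1)

/-- The one-step transition kernel of the walk, from histories up to time `n` to the next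
position. -/
noncomputable def stepKernel (ω : Environment) (n : ℕ) : Kernel (Finset.Iic n → ℤ) ℤ where
  toFun := stepMeasure ω
  measurable' := measurable_of_countable _

theorem rightProb_mem (ω : Environment) {n : ℕ} (h : Finset.Iic n → ℤ) :
    0 ≤ rightProb ω h ∧ rightProb ω h ≤ 1 := by
  unfold rightProb
  split_ifs
  · norm_num
  · have := (ω (current h)).2
    constructor <;> linarith [this.1, this.2]

instance (ω : Environment) (n : ℕ) : IsMarkovKernel (stepKernel ω n) where
  isProbabilityMeasure h := by
    constructor
    change stepMeasure ω h Set.univ = 1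
    obtain ⟨h0, h1⟩ := rightProb_mem ω h
    simp only [stepMeasure, Measure.add_apply, Measure.smul_apply, measure_univ, smul_eq_mul,
      mul_one]
    rw [← ENNReal.ofReal_add h0 (by linarith)]
    simp

/-- The quenched law `P^ω_x` on trajectories: the law (given by the Ionescu-Tulcea theorem) of the
walk `(X_n)` in the environment `ω` with `X_0 = x`. -/
noncomputable def quenchedLaw (ω : Environment) (x : ℤ) : Measure (ℕ → ℤ) :=
  Kernel.traj (X := fun _ => ℤ) (stepKernel ω) 0 (fun _ => x)

/-- The walk in the environment `ω` is recurrent: `P^ω_y (X_n = x i.o.) = 1` for all `x`, `y`. -/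
def Recurrent (ω : Environment) : Prop :=
  ∀ x y : ℤ, quenchedLaw ω y {X | ∃ᶠ n in atTop, X n = x} = 1

/-- The walk in the environment `ω` is transient: `P^ω_y (X_n = x i.o.) = 0` for all `x`, `y`. -/
def Transient (ω : Environment) : Prop :=
  ∀ x y : ℤ, quenchedLaw ω y {X | ∃ᶠ n in atTop, X n = x} = 0

end CookieWalk

/-! Write δ(x) = ω(x)/(1 - ω(x)) - 1 for `drift`, c(x,k) for `cross` (from a fresh x, reach k before
x - 1) and e(x) = lim c(x,k) for `escape` (from a fresh x, never visit x - 1). The walk is followed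
as a Markov chain on pairs (position, set of consumed cookies), so that probabilities up to time n
are finite recursions.

The heart is a balance equation. A fresh cookie at x gives a step of mean 2ω(x) - 1 and is consumed
with probability 1 - ω(x), and the quotient of the two is δ(x). Hence the position minus the total δ
of the consumed cookies is a martingale. Stopping it on exit from (-1,k), starting at 0, and
splitting the path at its first visit to x gives (k + 1) c(0,k) = 1 + ∑_{0 ≤ x < k} δ(x) c(0,x) (1 -
c(x,k)), in the form of the two inequalities `mul_cross_le` and `le_mul_cross`.

By ergodicity e(0) is either a.s. zero or a.s. positive. If it is positive, dividing by k shows that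
the averages of δ(x)(1 - e(x)) cannot stay below a constant c < 1 infinitely often. But a mean of δ
at most 1 makes the integral of δ(1 - e) strictly less than 1, and Fatou's lemma contradicts this.
If e = 0 a.s. while the mean of δ exceeds 1, some truncation min(δ,M)(1 - c(0,M)) still has mean
above 1; reverse Fatou then makes its averages exceed some c > 1 infinitely often, which the balance
equation forbids.

It remains to pass to trajectories. If e vanishes at every site, no site can be avoided forever from
any finite history, so the walk is recurrent. If e(0) > 0 a.s., Poincaré recurrence supplies
infinitely many sites to the right where e is at least some ε > 0. The walk reaches each of them
fresh, and there its conditional probability of returning to x infinitely often is at most 1 - ε;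
Lévy's zero-one law then excludes infinitely many returns. -/

namespace CookieWalk

open scoped Topology

/-! ### The walk as a Markov chain on pairs (position, set of consumed cookies) -/

open Classical in
/-- The probability of jumping to the right from `z` when the cookies in `C` are consumed. -/
noncomputable def rightWeight (ω : Environment) (C : Set ℤ) (z : ℤ) : ℝ :=
  if z ∈ C then 1 / 2 else (ω z : ℝ)

lemma rightWeight_of_mem {ω : Environment} {C : Set ℤ} {z : ℤ} (h : z ∈ C) :
    rightWeight ω C z = 1 / 2 := if_pos h

lemma rightWeight_of_notMem {ω : Environment} {C : Set ℤ} {z : ℤ} (h : z ∉ C) :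
    rightWeight ω C z = ω z := if_neg h

lemma rightWeight_congr (ω : Environment) {C D : Set ℤ} {z : ℤ} (h : z ∈ C ↔ z ∈ D) :
    rightWeight ω C z = rightWeight ω D z := by
  by_cases hz : z ∈ C
  · rw [rightWeight_of_mem hz, rightWeight_of_mem (h.1 hz)]
  · rw [rightWeight_of_notMem hz, rightWeight_of_notMem (mt h.2 hz)]

lemma half_le_rightWeight (ω : Environment) (C : Set ℤ) (z : ℤ) : 1 / 2 ≤ rightWeight ω C z := by
  unfold rightWeight
  split_ifs
  · exact le_rfl
  · exact (ω z).2.1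

lemma rightWeight_lt_one (ω : Environment) (C : Set ℤ) (z : ℤ) : rightWeight ω C z < 1 := by
  unfold rightWeight
  split_ifs
  · norm_num
  · exact (ω z).2.2

open Classical in
/-- The expectation of `F` at time `n` for the chain on pairs (position, set of consumed cookies),
started at `(z, C)` and stopped upon entering `S`. -/
noncomputable def stoppedExp (ω : Environment) (S : Set ℤ) (F : ℤ → Set ℤ → ℝ) :
    ℕ → ℤ → Set ℤ → ℝ
  | 0, z, C => F z C
  | n + 1, z, C => if z ∈ S then F z C else
      rightWeight ω C z * stoppedExp ω S F n (z + 1) C +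
        (1 - rightWeight ω C z) * stoppedExp ω S F n (z - 1) (insert z C)

variable {ω : Environment} {S : Set ℤ} {F G : ℤ → Set ℤ → ℝ}

@[simp]
lemma stoppedExp_zero (z : ℤ) (C : Set ℤ) : stoppedExp ω S F 0 z C = F z C := rfl

lemma stoppedExp_of_mem {z : ℤ} (hz : z ∈ S) (n : ℕ) (C : Set ℤ) :
    stoppedExp ω S F n z C = F z C := by
  cases n with
  | zero => rfl
  | succ n => simp [stoppedExp, hz]

lemma stoppedExp_succ {z : ℤ} (hz : z ∉ S) (n : ℕ) (C : Set ℤ) :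
    stoppedExp ω S F (n + 1) z C = rightWeight ω C z * stoppedExp ω S F n (z + 1) C +
        (1 - rightWeight ω C z) * stoppedExp ω S F n (z - 1) (insert z C) := by
  simp [stoppedExp, hz]

lemma average_le_average (ω : Environment) (C : Set ℤ) (z : ℤ) {a b c d : ℝ} (h₁ : a ≤ c)
    (h₂ : b ≤ d) :
    rightWeight ω C z * a + (1 - rightWeight ω C z) * b ≤
      rightWeight ω C z * c + (1 - rightWeight ω C z) * d := by
  have := half_le_rightWeight ω C z
  have := rightWeight_lt_one ω C z
  gcongr

/-- Monotonicity in the payoff, on a set of states closed under the dynamics. -/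
lemma stoppedExp_mono_on {I : ℤ → Set ℤ → Prop}
    (hI : ∀ z C, z ∉ S → I z C → I (z + 1) C ∧ I (z - 1) (insert z C))
    (h : ∀ z C, I z C → F z C ≤ G z C) (n : ℕ) :
    ∀ {z : ℤ} {C : Set ℤ}, I z C → stoppedExp ω S F n z C ≤ stoppedExp ω S G n z C := by
  induction n with
  | zero => exact fun hz => h _ _ hz
  | succ n ih =>
    intro z C hz
    by_cases hS : z ∈ S
    · simpa [stoppedExp_of_mem hS] using h _ _ hz
    · rw [stoppedExp_succ hS, stoppedExp_succ hS]
      exact average_le_average _ _ _ (ih (hI _ _ hS hz).1) (ih (hI _ _ hS hz).2)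

lemma stoppedExp_mono (h : ∀ z C, F z C ≤ G z C) (n : ℕ) (z : ℤ) (C : Set ℤ) :
    stoppedExp ω S F n z C ≤ stoppedExp ω S G n z C :=
  stoppedExp_mono_on (I := fun _ _ => True) (by simp) (fun z C _ => h z C) n trivial

lemma stoppedExp_add (n : ℕ) (z : ℤ) (C : Set ℤ) :
    stoppedExp ω S (fun z C => F z C + G z C) n z C =
      stoppedExp ω S F n z C + stoppedExp ω S G n z C := by
  induction n generalizing z C with
  | zero => rfl
  | succ n ih =>
    by_cases hS : z ∈ S
    · simp [stoppedExp_of_mem hS]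
    · simp only [stoppedExp_succ hS, ih]; ring

lemma stoppedExp_const_mul (c : ℝ) (n : ℕ) (z : ℤ) (C : Set ℤ) :
    stoppedExp ω S (fun z C => c * F z C) n z C = c * stoppedExp ω S F n z C := by
  induction n generalizing z C with
  | zero => rfl
  | succ n ih =>
    by_cases hS : z ∈ S
    · simp [stoppedExp_of_mem hS]
    · simp only [stoppedExp_succ hS, ih]; ring

lemma stoppedExp_const (c : ℝ) (n : ℕ) (z : ℤ) (C : Set ℤ) :
    stoppedExp ω S (fun _ _ => c) n z C = c := by
  induction n generalizing z C with
  | zero => rfl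
  | succ n ih =>
    by_cases hS : z ∈ S
    · simp [stoppedExp_of_mem hS]
    · simp only [stoppedExp_succ hS, ih]; ring

lemma stoppedExp_sum {ι : Type*} (s : Finset ι) (H : ι → ℤ → Set ℤ → ℝ) (n : ℕ) (z : ℤ)
    (C : Set ℤ) :
    stoppedExp ω S (fun z C => ∑ i ∈ s, H i z C) n z C = ∑ i ∈ s, stoppedExp ω S (H i) n z C := by
  classical
  induction s using Finset.induction_on with
  | empty => simpa using stoppedExp_const 0 n z C
  | insert a s ha ih => simp only [Finset.sum_insert ha, stoppedExp_add, ih]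

/-- Optional stopping for functions that are harmonic off `S`. -/
lemma stoppedExp_eq_of_harmonic
    (h : ∀ z C, z ∉ S → rightWeight ω C z * F (z + 1) C +
      (1 - rightWeight ω C z) * F (z - 1) (insert z C) = F z C) (n : ℕ) (z : ℤ) (C : Set ℤ) :
    stoppedExp ω S F n z C = F z C := by
  induction n generalizing z C with
  | zero => rfl
  | succ n ih =>
    by_cases hS : z ∈ S
    · simp [stoppedExp_of_mem hS]
    · simp only [stoppedExp_succ hS, ih, h z C hS]

lemma stoppedExp_le_succ_of_subharmonic
    (h : ∀ z C, z ∉ S → F z C ≤ rightWeight ω C z * F (z + 1) C +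
      (1 - rightWeight ω C z) * F (z - 1) (insert z C)) (n : ℕ) (z : ℤ) (C : Set ℤ) :
    stoppedExp ω S F n z C ≤ stoppedExp ω S F (n + 1) z C := by
  induction n generalizing z C with
  | zero =>
    by_cases hS : z ∈ S
    · simp [stoppedExp_of_mem hS]
    · simpa [stoppedExp_succ hS] using h z C hS
  | succ n ih =>
    by_cases hS : z ∈ S
    · simp [stoppedExp_of_mem hS]
    · rw [stoppedExp_succ hS, stoppedExp_succ hS]
      exact average_le_average _ _ _ (ih _ _) (ih _ _)

/-- Cookies at sites that the stopped walk cannot use do not matter. -/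
lemma stoppedExp_congr_consumed {f : ℤ → ℝ} {U : Set ℤ}
    (hU : ∀ z ∈ U, z ∉ S → z + 1 ∈ U ∧ z - 1 ∈ U) (n : ℕ) :
    ∀ {z : ℤ} {C D : Set ℤ}, z ∈ U → (∀ x ∈ U, x ∉ S → (x ∈ C ↔ x ∈ D)) →
      stoppedExp ω S (fun z _ => f z) n z C = stoppedExp ω S (fun z _ => f z) n z D := by
  induction n with
  | zero => intros; rfl
  | succ n ih =>
    intro z C D hz h
    by_cases hS : z ∈ S
    · simp [stoppedExp_of_mem hS]
    · have hp : rightWeight ω C z = rightWeight ω D z := rightWeight_congr ω (h z hz hS)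
      rw [stoppedExp_succ hS, stoppedExp_succ hS, hp, ih (hU z hz hS).1 h,
        ih (C := insert z C) (D := insert z D) (hU z hz hS).2 fun x hx hxS => by
          simp [h x hx hxS]]

lemma stoppedExp_shift {f : ℤ → ℝ} (n : ℕ) (z : ℤ) (C : Set ℤ) :
    stoppedExp (shift ω) ((· + 1) ⁻¹' S) (fun z _ => f (z + 1)) n z ((· + 1) ⁻¹' C) =
      stoppedExp ω S (fun z _ => f z) n (z + 1) C := by
  induction n generalizing z C with
  | zero => rfl
  | succ n ih =>
    by_cases hS : z + 1 ∈ S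
    · rw [stoppedExp_of_mem hS, stoppedExp_of_mem (by exact hS)]
    · rw [stoppedExp_succ hS, stoppedExp_succ (by exact hS), ih]
      have h1 : insert z ((· + 1) ⁻¹' C) = (· + 1) ⁻¹' (insert (z + 1) C : Set ℤ) := by
        ext x; simp
      have h2 : rightWeight (shift ω) ((· + 1) ⁻¹' C) z = rightWeight ω C (z + 1) := rfl
      rw [h1, ih, h2, sub_add_cancel, add_sub_cancel_right]

lemma measurable_stoppedExp (S : Set ℤ) (F : ℤ → Set ℤ → ℝ) (n : ℕ) (z : ℤ) (C : Set ℤ) :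
    Measurable fun ω => stoppedExp ω S F n z C := by
  induction n generalizing z C with
  | zero => exact measurable_const
  | succ n ih =>
    have hp : Measurable fun ω : Environment => rightWeight ω C z := by
      unfold rightWeight
      split_ifs
      · exact measurable_const
      · exact measurable_subtype_coe.comp (measurable_pi_apply z)
    by_cases hS : z ∈ S
    · simp only [stoppedExp_of_mem hS]; exact measurable_const
    · simp only [stoppedExp_succ hS]
      exact (hp.mul (ih _ _)).add ((measurable_const.sub hp).mul (ih _ _))

/-! ### Avoiding a site -/

/-- The probability that the chain started at `(z, C)` does not visit `x` at times `0, …, n`. -/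
noncomputable def avoid (ω : Environment) (x : ℤ) (n : ℕ) (z : ℤ) (C : Set ℤ) : ℝ :=
  stoppedExp ω {x} (fun z _ => if z = x then 0 else 1) n z C

lemma avoid_self (ω : Environment) (x : ℤ) (n : ℕ) (C : Set ℤ) : avoid ω x n x C = 0 := by
  simp [avoid, stoppedExp_of_mem (Set.mem_singleton x)]

lemma avoid_zero {x z : ℤ} (h : z ≠ x) (C : Set ℤ) : avoid ω x 0 z C = 1 := by
  simp [avoid, h]

lemma avoid_succ {x z : ℤ} (h : z ≠ x) (n : ℕ) (C : Set ℤ) :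
    avoid ω x (n + 1) z C = rightWeight ω C z * avoid ω x n (z + 1) C +
        (1 - rightWeight ω C z) * avoid ω x n (z - 1) (insert z C) :=
  stoppedExp_succ (by simpa using h) n C

lemma avoid_nonneg (ω : Environment) (x : ℤ) (n : ℕ) (z : ℤ) (C : Set ℤ) :
    0 ≤ avoid ω x n z C := by
  rw [← stoppedExp_const (ω := ω) (S := {x}) 0 n z C]
  exact stoppedExp_mono (fun z C => by split_ifs <;> norm_num) _ _ _

lemma avoid_le_one (ω : Environment) (x : ℤ) (n : ℕ) (z : ℤ) (C : Set ℤ) :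
    avoid ω x n z C ≤ 1 := by
  rw [← stoppedExp_const (ω := ω) (S := {x}) 1 n z C]
  exact stoppedExp_mono (fun z C => by split_ifs <;> norm_num) _ _ _

lemma avoid_succ_le (ω : Environment) (x : ℤ) (n : ℕ) (z : ℤ) (C : Set ℤ) :
    avoid ω x (n + 1) z C ≤ avoid ω x n z C := by
  induction n generalizing z C with
  | zero =>
    by_cases h : z = x
    · subst h; simp [avoid_self]
    · rw [avoid_zero h]; exact avoid_le_one _ _ _ _ _
  | succ n ih =>
    by_cases h : z = x
    · subst h; simp [avoid_self]
    · rw [avoid_succ h (n + 1), avoid_succ h n]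
      exact average_le_average _ _ _ (ih _ _) (ih _ _)

lemma antitone_avoid (ω : Environment) (x z : ℤ) (C : Set ℤ) :
    Antitone fun n => avoid ω x n z C :=
  antitone_nat_of_succ_le fun n => avoid_succ_le ω x n z C

/-- The probability that the chain started at `(z, C)` never visits `x`. -/
noncomputable def avoidForever (ω : Environment) (x z : ℤ) (C : Set ℤ) : ℝ :=
  ⨅ n, avoid ω x n z C

lemma bddBelow_avoid (ω : Environment) (x z : ℤ) (C : Set ℤ) :
    BddBelow (Set.range fun n => avoid ω x n z C) :=
  ⟨0, by rintro _ ⟨n, rfl⟩; exact avoid_nonneg _ _ _ _ _⟩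

lemma tendsto_avoid (ω : Environment) (x z : ℤ) (C : Set ℤ) :
    Tendsto (fun n => avoid ω x n z C) atTop (𝓝 (avoidForever ω x z C)) :=
  tendsto_atTop_ciInf (antitone_avoid ω x z C) (bddBelow_avoid ω x z C)

lemma avoidForever_le (ω : Environment) (x : ℤ) (n : ℕ) (z : ℤ) (C : Set ℤ) :
    avoidForever ω x z C ≤ avoid ω x n z C :=
  ciInf_le (bddBelow_avoid ω x z C) n

lemma avoidForever_nonneg (ω : Environment) (x z : ℤ) (C : Set ℤ) :
    0 ≤ avoidForever ω x z C :=
  le_ciInf fun _ => avoid_nonneg _ _ _ _ _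

lemma avoidForever_le_one (ω : Environment) (x z : ℤ) (C : Set ℤ) :
    avoidForever ω x z C ≤ 1 :=
  (avoidForever_le ω x 0 z C).trans (avoid_le_one _ _ _ _ _)

/-- Avoiding a site further to the left is easier. -/
lemma avoid_mono_target {x y : ℤ} (hxy : x ≤ y) (n : ℕ) :
    ∀ {z : ℤ} {C : Set ℤ}, y ≤ z → avoid ω y n z C ≤ avoid ω x n z C := by
  induction n with
  | zero =>
    intro z C hz
    rcases hz.eq_or_lt with rfl | h
    · rw [avoid_self]; exact avoid_nonneg _ _ _ _ _
    · rw [avoid_zero h.ne', avoid_zero (by omega)]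
  | succ n ih =>
    intro z C hz
    rcases hz.eq_or_lt with rfl | h
    · rw [avoid_self]; exact avoid_nonneg _ _ _ _ _
    · rw [avoid_succ h.ne', avoid_succ (by omega)]
      exact average_le_average _ _ _ (ih (by omega)) (ih (by omega))

lemma avoidForever_mono_target {x y z : ℤ} {C : Set ℤ} (hxy : x ≤ y) (hz : y ≤ z) :
    avoidForever ω y z C ≤ avoidForever ω x z C :=
  ciInf_mono (bddBelow_avoid ω y z C) fun n => avoid_mono_target hxy n hz

lemma avoid_congr_consumed {x z : ℤ} {C D : Set ℤ} (hz : x ≤ z)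
    (h : ∀ y, x < y → (y ∈ C ↔ y ∈ D)) (n : ℕ) : avoid ω x n z C = avoid ω x n z D :=
  stoppedExp_congr_consumed (f := fun z => if z = x then 0 else 1) (U := Set.Ici x)
    (fun z hz hS => by
      simp only [Set.mem_Ici, Set.mem_singleton_iff] at *; omega) n hz
    fun y hy hS => h y (lt_of_le_of_ne hy fun e => hS (by simp [e]))

lemma avoidForever_congr_consumed {x z : ℤ} {C D : Set ℤ} (hz : x ≤ z)
    (h : ∀ y, x < y → (y ∈ C ↔ y ∈ D)) : avoidForever ω x z C = avoidForever ω x z D := by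
  simp only [avoidForever, avoid_congr_consumed hz h]

/-- Consuming one more cookie increases the probability to avoid a site by a bounded factor at
most. -/
lemma avoid_insert_le (x d : ℤ) (n : ℕ) (z : ℤ) (C : Set ℤ) :
    avoid ω x n z (insert d C) ≤ (1 / (2 * (1 - (ω d : ℝ)))) * avoid ω x n z C := by
  have hd0 := (ω d).2.1
  have hd1 := (ω d).2.2
  set c : ℝ := 1 / (2 * (1 - (ω d : ℝ))) with hc
  -- `c` is the ratio of the left-step probabilities at `d` with and without its cookie consumed.
  -- After a left step from `d` both chains are in the same state; a right step is only likelier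
  -- with the cookie present, so `c ≥ 1` and the induction cover it.
  have hc1 : 1 ≤ c := by rw [hc, le_div_iff₀ (by linarith)]; linarith
  have hc2 : (1 - (ω d : ℝ)) * c = 1 / 2 := by
    rw [hc]; field_simp [show (1 - (ω d : ℝ)) ≠ 0 by linarith]
  induction n generalizing z C with
  | zero =>
    by_cases h : z = x
    · subst h; simp [avoid_self]
    · rw [avoid_zero h, avoid_zero h]; linarith
  | succ n ih =>
    by_cases h : z = x
    · subst h; simp [avoid_self]
    by_cases hdC : d ∈ C
    · rw [Set.insert_eq_of_mem hdC]
      nlinarith [avoid_nonneg ω x (n + 1) z C]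
    rw [avoid_succ h, avoid_succ h]
    by_cases hz : z = d
    · subst hz
      rw [rightWeight_of_mem (Set.mem_insert z C), rightWeight_of_notMem hdC,
        Set.insert_eq_of_mem (Set.mem_insert z C)]
      have h1 := ih (z + 1) C
      have h2 : 0 ≤ avoid ω x n (z - 1) (insert z C) := avoid_nonneg _ _ _ _ _
      have h3 : 0 ≤ avoid ω x n (z + 1) C := avoid_nonneg _ _ _ _ _
      have h4 : 1 / 2 * (c * avoid ω x n (z + 1) C) ≤ ω z * (c * avoid ω x n (z + 1) C) := by
        gcongr
      linear_combination (1 / 2) * h1 + h4 - avoid ω x n (z - 1) (insert z C) * hc2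
    · have hp : rightWeight ω (insert d C) z = rightWeight ω C z :=
        rightWeight_congr ω (by simp [hz])
      rw [hp, Set.insert_comm]
      refine (average_le_average _ _ _ (ih _ _) (ih _ _)).trans_eq ?_
      ring

lemma avoidForever_insert_le (x d z : ℤ) (C : Set ℤ) :
    avoidForever ω x z (insert d C) ≤ (1 / (2 * (1 - (ω d : ℝ)))) * avoidForever ω x z C :=
  le_of_tendsto_of_tendsto' (tendsto_avoid _ _ _ _) ((tendsto_avoid _ _ _ _).const_mul _)
    fun n => avoid_insert_le x d n z C

lemma avoidForever_eq_zero_of_finite {x z : ℤ} (h : avoidForever ω x z ∅ = 0) {C : Set ℤ}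
    (hC : C.Finite) : avoidForever ω x z C = 0 := by
  induction C, hC using Set.Finite.induction_on with
  | empty => exact h
  | insert _ _ ih =>
    refine le_antisymm ?_ (avoidForever_nonneg _ _ _ _)
    exact (avoidForever_insert_le _ _ _ _).trans_eq (by rw [ih, mul_zero])

/-- A right step has probability at least 1/2 and leaves the consumed set unchanged. -/
lemma half_mul_avoid_le {x z : ℤ} (h : z ≠ x) (n : ℕ) (C : Set ℤ) :
    1 / 2 * avoid ω x n (z + 1) C ≤ avoid ω x (n + 1) z C := by
  rw [avoid_succ h]
  have h1 := half_le_rightWeight ω C z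
  have h2 := rightWeight_lt_one ω C z
  have h3 := avoid_nonneg ω x n (z + 1) C
  have h4 := avoid_nonneg ω x n (z - 1) (insert z C)
  nlinarith

lemma half_mul_avoidForever_le {x z : ℤ} (h : z ≠ x) (C : Set ℤ) :
    1 / 2 * avoidForever ω x (z + 1) C ≤ avoidForever ω x z C :=
  le_of_tendsto_of_tendsto' ((tendsto_avoid _ _ _ _).const_mul _)
    ((tendsto_avoid _ _ _ _).comp (tendsto_add_atTop_nat 1)) fun n => half_mul_avoid_le h n C

/-- With u = x - z, the term u/L is the chance that a simple random walk reaches distance L before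
x, and u(2L - u) is its expected time to hit x when reflected at distance L. Both increase in u on
[0,L], so a drift towards x preserves the bound; at distance L the sum is bounded trivially by its
number of terms. -/
lemma sum_avoid_le (x : ℤ) (L : ℕ) (n : ℕ) :
    ∀ (z : ℤ) (C : Set ℤ), z ≤ x → x ≤ z + L →
      ∑ j ∈ Finset.range n, avoid ω x j z C ≤
        n * ((x - z : ℝ) / L) + (x - z : ℝ) * (2 * L - (x - z)) := by
  induction n with
  | zero =>
    intro z C h1 h2
    have h1' : (z : ℝ) ≤ x := by exact_mod_cast h1
    have h2' : (x : ℝ) ≤ z + L := by exact_mod_cast h2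
    simp only [Finset.range_zero, Finset.sum_empty, Nat.cast_zero, zero_mul, zero_add]
    exact mul_nonneg (by linarith) (by linarith)
  | succ n ih =>
    intro z C h1 h2
    have h1' : (z : ℝ) ≤ x := by exact_mod_cast h1
    have h2' : (x : ℝ) ≤ z + L := by exact_mod_cast h2
    rcases h1.eq_or_lt with rfl | hlt
    · simp [avoid_self]
    have hlt' : (z : ℝ) + 1 ≤ x := by exact_mod_cast hlt
    have hL : (0 : ℝ) < L := by linarith
    rcases h2.eq_or_lt with he | hlt2
    · have he' : (x : ℝ) = z + L := by exact_mod_cast he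
      have : ∑ j ∈ Finset.range (n + 1), avoid ω x j z C ≤ ∑ j ∈ Finset.range (n + 1), (1 : ℝ) :=
        Finset.sum_le_sum fun j _ => avoid_le_one _ _ _ _ _
      refine this.trans ?_
      rw [he', add_sub_cancel_left, div_self hL.ne']
      simp only [Finset.sum_const, Finset.card_range, nsmul_eq_mul, mul_one]
      nlinarith
    have hlt2' : (x : ℝ) + 1 ≤ z + L := by exact_mod_cast hlt2
    have ih1 := ih (z + 1) C (by omega) (by omega)
    have ih2 := ih (z - 1) (insert z C) (by omega) (by omega)
    rw [Finset.sum_range_succ', avoid_zero hlt.ne]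
    simp only [avoid_succ hlt.ne, Finset.sum_add_distrib, ← Finset.mul_sum]
    have hp := half_le_rightWeight ω C z
    refine (add_le_add_left (average_le_average ω C z ih1 ih2) 1).trans ?_
    set p := rightWeight ω C z
    push_cast
    set a : ℝ := (L : ℝ)⁻¹
    have ha : 0 < a := inv_pos.2 hL
    have hn : (0 : ℝ) ≤ n := n.cast_nonneg
    simp only [div_eq_mul_inv]
    -- At p = 1/2 the quadratic term falls by exactly 1, which pays for the term j = 0. The factor
    -- multiplying p - 1/2 is the drop of the bound from z - 1 to z + 1.
    have key : 0 ≤ (p - 1 / 2) * (2 * n * a + 4 * (L - (x - z))) :=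
      mul_nonneg (by linarith) (by nlinarith [mul_nonneg hn ha.le])
    have key2 : 0 ≤ (x - z : ℝ) * a := mul_nonneg (by linarith) ha.le
    linear_combination key + key2

/-- The walk reaches every site to the right of its starting point. -/
lemma avoidForever_eq_zero_of_le {x z : ℤ} (hz : z ≤ x) (C : Set ℤ) :
    avoidForever ω x z C = 0 := by
  refine le_antisymm ?_ (avoidForever_nonneg _ _ _ _)
  -- Dividing `sum_avoid_le` by the number of terms leaves only (x - z)/L in the limit; L is then
  -- sent to infinity.
  have key : ∀ L : ℕ, x ≤ z + L → avoidForever ω x z C ≤ (x - z : ℝ) / L := by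
    intro L hL
    have hlim : Tendsto (fun n : ℕ => (x - z : ℝ) / L +
        (x - z : ℝ) * (2 * L - (x - z)) * (1 / ((n : ℝ) + 1))) atTop (𝓝 ((x - z : ℝ) / L)) := by
      simpa using tendsto_const_nhds.add
        (tendsto_one_div_add_atTop_nhds_zero_nat.const_mul ((x - z : ℝ) * (2 * L - (x - z))))
    refine ge_of_tendsto' hlim fun n => ?_
    have h1 := sum_avoid_le (ω := ω) x L (n + 1) z C hz hL
    have h2 : ∑ j ∈ Finset.range (n + 1), avoidForever ω x z C ≤
        ∑ j ∈ Finset.range (n + 1), avoid ω x j z C :=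
      Finset.sum_le_sum fun j _ => avoidForever_le _ _ _ _ _
    rw [Finset.sum_const, Finset.card_range, nsmul_eq_mul] at h2
    have h3 := h2.trans h1
    have hn : (0 : ℝ) < (n : ℝ) + 1 := by positivity
    push_cast at h3
    rw [← mul_le_mul_iff_of_pos_left hn]
    refine h3.trans_eq ?_
    field_simp
  refine ge_of_tendsto (tendsto_const_div_atTop_nhds_zero_nat (x - z : ℝ)) ?_
  filter_upwards [eventually_ge_atTop (x - z).toNat] with L hL
  exact key L (by omega)

/-! ### Crossing an interval -/

/-- The complement of the open interval `(l, k)`. -/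
def outside (l k : ℤ) : Set ℤ := {z | z ≤ l ∨ k ≤ z}

lemma notMem_outside {l k z : ℤ} : z ∉ outside l k ↔ l < z ∧ z < k := by
  simp [outside]

/-- The probability that the chain started at `(z, C)` exits `(l, k)` on the right by time `n`. -/
noncomputable def exitRight (ω : Environment) (l k : ℤ) (n : ℕ) (z : ℤ) (C : Set ℤ) : ℝ :=
  stoppedExp ω (outside l k) (fun z _ => if k ≤ z then 1 else 0) n z C

/-- The probability that the chain started at `(z, C)` exits `(l, k)` on the left by time `n`. -/
noncomputable def exitLeft (ω : Environment) (l k : ℤ) (n : ℕ) (z : ℤ) (C : Set ℤ) : ℝ :=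
  stoppedExp ω (outside l k) (fun z _ => if z ≤ l then 1 else 0) n z C

/-- The probability that the chain started at `(z, C)` stays in `(l, k)` up to time `n`. -/
noncomputable def stayInside (ω : Environment) (l k : ℤ) (n : ℕ) (z : ℤ) (C : Set ℤ) : ℝ :=
  stoppedExp ω (outside l k) (fun z _ => if l < z ∧ z < k then 1 else 0) n z C

lemma exit_add_stayInside {l k : ℤ} (hlk : l < k) (n : ℕ) (z : ℤ) (C : Set ℤ) :
    exitLeft ω l k n z C + exitRight ω l k n z C + stayInside ω l k n z C = 1 := by
  unfold exitLeft exitRight stayInside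
  rw [← stoppedExp_add, ← stoppedExp_add]
  refine Eq.trans ?_ (stoppedExp_const (ω := ω) (S := outside l k) 1 n z C)
  congr 1
  funext z C
  split_ifs <;> first | omega | norm_num

lemma exitRight_nonneg (ω : Environment) (l k : ℤ) (n : ℕ) (z : ℤ) (C : Set ℤ) :
    0 ≤ exitRight ω l k n z C := by
  rw [← stoppedExp_const (ω := ω) (S := outside l k) 0 n z C]
  exact stoppedExp_mono (fun z C => by split_ifs <;> norm_num) _ _ _

lemma exitRight_le_one (ω : Environment) (l k : ℤ) (n : ℕ) (z : ℤ) (C : Set ℤ) :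
    exitRight ω l k n z C ≤ 1 := by
  rw [← stoppedExp_const (ω := ω) (S := outside l k) 1 n z C]
  exact stoppedExp_mono (fun z C => by split_ifs <;> norm_num) _ _ _

lemma stayInside_nonneg (ω : Environment) (l k : ℤ) (n : ℕ) (z : ℤ) (C : Set ℤ) :
    0 ≤ stayInside ω l k n z C := by
  rw [← stoppedExp_const (ω := ω) (S := outside l k) 0 n z C]
  exact stoppedExp_mono (fun z C => by split_ifs <;> norm_num) _ _ _

/-- A nonnegative payoff that vanishes off `S` yields a monotone sequence of expectations. -/
lemma stoppedExp_le_succ_of_zero {S : Set ℤ} {F : ℤ → Set ℤ → ℝ} (h0 : ∀ z C, 0 ≤ F z C)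
    (hS : ∀ z C, z ∉ S → F z C = 0) (n : ℕ) (z : ℤ) (C : Set ℤ) :
    stoppedExp ω S F n z C ≤ stoppedExp ω S F (n + 1) z C := by
  refine stoppedExp_le_succ_of_subharmonic (fun z C hz => ?_) n z C
  rw [hS z C hz]
  have := average_le_average ω C z (h0 (z + 1) C) (h0 (z - 1) (insert z C))
  simpa using this

lemma monotone_exitRight (ω : Environment) (l k z : ℤ) (C : Set ℤ) :
    Monotone fun n => exitRight ω l k n z C :=
  monotone_nat_of_le_succ fun n => stoppedExp_le_succ_of_zero
    (fun z C => by split_ifs <;> norm_num)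
    (fun z C hz => if_neg (by have := notMem_outside.1 hz; omega)) n z C

lemma monotone_exitLeft (ω : Environment) (l k z : ℤ) (C : Set ℤ) :
    Monotone fun n => exitLeft ω l k n z C :=
  monotone_nat_of_le_succ fun n => stoppedExp_le_succ_of_zero
    (fun z C => by split_ifs <;> norm_num)
    (fun z C hz => if_neg (by have := notMem_outside.1 hz; omega)) n z C

lemma exitRight_of_le {l k z : ℤ} (h : k ≤ z) (n : ℕ) (C : Set ℤ) :
    exitRight ω l k n z C = 1 := by
  rw [exitRight, stoppedExp_of_mem (Or.inr h), if_pos h]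

lemma exitRight_of_le_left {l k z : ℤ} (hlk : l < k) (h : z ≤ l) (n : ℕ) (C : Set ℤ) :
    exitRight ω l k n z C = 0 := by
  rw [exitRight, stoppedExp_of_mem (Or.inl h), if_neg (by omega)]

lemma exitRight_zero {l k z : ℤ} (h : z < k) (C : Set ℤ) : exitRight ω l k 0 z C = 0 := by
  rw [exitRight, stoppedExp_zero, if_neg (by omega)]

lemma exitRight_succ {l k z : ℤ} (h₁ : l < z) (h₂ : z < k) (n : ℕ) (C : Set ℤ) :
    exitRight ω l k (n + 1) z C = rightWeight ω C z * exitRight ω l k n (z + 1) C +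
        (1 - rightWeight ω C z) * exitRight ω l k n (z - 1) (insert z C) :=
  stoppedExp_succ (notMem_outside.2 ⟨h₁, h₂⟩) n C

lemma exitLeft_succ {l k z : ℤ} (h₁ : l < z) (h₂ : z < k) (n : ℕ) (C : Set ℤ) :
    exitLeft ω l k (n + 1) z C = rightWeight ω C z * exitLeft ω l k n (z + 1) C +
        (1 - rightWeight ω C z) * exitLeft ω l k n (z - 1) (insert z C) :=
  stoppedExp_succ (notMem_outside.2 ⟨h₁, h₂⟩) n C

lemma stayInside_succ {l k z : ℤ} (h₁ : l < z) (h₂ : z < k) (n : ℕ) (C : Set ℤ) :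
    stayInside ω l k (n + 1) z C = rightWeight ω C z * stayInside ω l k n (z + 1) C +
        (1 - rightWeight ω C z) * stayInside ω l k n (z - 1) (insert z C) :=
  stoppedExp_succ (notMem_outside.2 ⟨h₁, h₂⟩) n C

lemma stayInside_of_outside {l k z : ℤ} (h : z ≤ l ∨ k ≤ z) (n : ℕ) (C : Set ℤ) :
    stayInside ω l k n z C = 0 := by
  rw [stayInside, stoppedExp_of_mem h, if_neg (by omega)]

lemma stayInside_le_avoid (l k : ℤ) (n : ℕ) :
    ∀ z C, stayInside ω l k n z C ≤ avoid ω k n z C := by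
  induction n with
  | zero =>
    intro z C
    by_cases h : l < z ∧ z < k
    · rw [avoid_zero h.2.ne, stayInside, stoppedExp_zero, if_pos h]
    · rw [stayInside_of_outside (by omega)]; exact avoid_nonneg _ _ _ _ _
  | succ n ih =>
    intro z C
    by_cases h : l < z ∧ z < k
    · rw [avoid_succ h.2.ne, stayInside_succ h.1 h.2]
      exact average_le_average _ _ _ (ih _ _) (ih _ _)
    · rw [stayInside_of_outside (by omega)]; exact avoid_nonneg _ _ _ _ _

/-- The walk reaches `k` almost surely from the left, so it cannot stay below `k` forever. -/
lemma tendsto_stayInside (ω : Environment) (l k z : ℤ) (C : Set ℤ) :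
    Tendsto (fun n => stayInside ω l k n z C) atTop (𝓝 0) := by
  rcases le_or_gt z k with h | h
  · refine squeeze_zero (fun n => stayInside_nonneg _ _ _ _ _ _)
      (fun n => stayInside_le_avoid l k n z C) ?_
    simpa [avoidForever_eq_zero_of_le h] using tendsto_avoid ω k z C
  · simp [stayInside_of_outside (Or.inr h.le)]

/-- The probability that the chain started at `x` with all cookies present reaches `k` before
`x - 1`. -/
noncomputable def cross (ω : Environment) (x k : ℤ) : ℝ := ⨆ n, exitRight ω (x - 1) k n x ∅

/-- The probability that the chain started at `x` with all cookies present never visits `x - 1`. -/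
noncomputable def escape (ω : Environment) (x : ℤ) : ℝ := avoidForever ω (x - 1) x ∅

lemma bddAbove_exitRight (ω : Environment) (l k z : ℤ) (C : Set ℤ) :
    BddAbove (Set.range fun n => exitRight ω l k n z C) :=
  ⟨1, by rintro _ ⟨n, rfl⟩; exact exitRight_le_one _ _ _ _ _ _⟩

lemma exitRight_le_cross (ω : Environment) (x k : ℤ) (n : ℕ) :
    exitRight ω (x - 1) k n x ∅ ≤ cross ω x k :=
  le_ciSup (bddAbove_exitRight ω (x - 1) k x ∅) n

lemma tendsto_exitRight (ω : Environment) (x k : ℤ) :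
    Tendsto (fun n => exitRight ω (x - 1) k n x ∅) atTop (𝓝 (cross ω x k)) :=
  tendsto_atTop_ciSup (monotone_exitRight ω _ k x ∅) (bddAbove_exitRight ω _ k x ∅)

lemma cross_nonneg (ω : Environment) (x k : ℤ) : 0 ≤ cross ω x k :=
  (exitRight_nonneg ω (x - 1) k 0 x ∅).trans (exitRight_le_cross ω x k 0)

lemma cross_le_one (ω : Environment) (x k : ℤ) : cross ω x k ≤ 1 :=
  ciSup_le fun _ => exitRight_le_one _ _ _ _ _ _

lemma tendsto_exitLeft (ω : Environment) {x k : ℤ} (h : x - 1 < k) :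
    Tendsto (fun n => exitLeft ω (x - 1) k n x ∅) atTop (𝓝 (1 - cross ω x k)) := by
  have := (tendsto_const_nhds (x := (1 : ℝ))).sub
    ((tendsto_exitRight ω x k).add (tendsto_stayInside ω (x - 1) k x ∅))
  rw [add_zero] at this
  refine this.congr fun n => ?_
  linarith [exit_add_stayInside (ω := ω) h n x ∅]

lemma exitLeft_le (ω : Environment) {x k : ℤ} (h : x - 1 < k) (n : ℕ) :
    exitLeft ω (x - 1) k n x ∅ ≤ 1 - cross ω x k :=
  (monotone_exitLeft ω (x - 1) k x ∅).ge_of_tendsto (tendsto_exitLeft ω h) n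

lemma exitLeft_congr_consumed {x k : ℤ} {C : Set ℤ} (h : ∀ y, x ≤ y → y ∉ C) (n : ℕ) :
    exitLeft ω (x - 1) k n x C = exitLeft ω (x - 1) k n x ∅ :=
  stoppedExp_congr_consumed (f := fun z => if z ≤ x - 1 then 1 else 0) (U := Set.univ)
    (by simp) n (Set.mem_univ _) fun y _ hy => by
      have := notMem_outside.1 hy
      simp [h y (by omega)]

lemma exitRight_anti {l k : ℤ} (hlk : l < k) (n : ℕ) :
    ∀ z C, exitRight ω l (k + 1) n z C ≤ exitRight ω l k n z C := by
  induction n with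
  | zero =>
    intro z C
    rcases le_or_gt k z with h | h
    · rw [exitRight_of_le h]; exact exitRight_le_one _ _ _ _ _ _
    · rw [exitRight_zero h, exitRight_zero (by omega)]
  | succ n ih =>
    intro z C
    rcases le_or_gt k z with h | h
    · rw [exitRight_of_le h]; exact exitRight_le_one _ _ _ _ _ _
    rcases le_or_gt z l with h2 | h2
    · rw [exitRight_of_le_left hlk h2, exitRight_of_le_left (by omega) h2]
    · rw [exitRight_succ h2 (by omega), exitRight_succ h2 h]
      exact average_le_average _ _ _ (ih _ _) (ih _ _)

lemma antitone_cross (ω : Environment) : Antitone fun k : ℕ => cross ω 0 k :=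
  antitone_nat_of_succ_le fun k => by
    push_cast
    exact ciSup_mono (bddAbove_exitRight ω _ k 0 ∅) fun n => exitRight_anti (by omega) n 0 ∅

lemma avoid_le_exitRight_add {l k : ℤ} (n : ℕ) :
    ∀ {z C}, l ≤ z → avoid ω l n z C ≤ exitRight ω l k n z C + stayInside ω l k n z C := by
  induction n with
  | zero =>
    intro z C hz
    rcases le_or_gt k z with h | h
    · rw [exitRight_of_le h]
      linarith [avoid_le_one ω l 0 z C, stayInside_nonneg ω l k 0 z C]
    rcases hz.eq_or_lt with rfl | h2
    · rw [avoid_self]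
      exact add_nonneg (exitRight_nonneg _ _ _ _ _ _) (stayInside_nonneg _ _ _ _ _ _)
    · rw [avoid_zero h2.ne', exitRight_zero h, stayInside, stoppedExp_zero, if_pos ⟨h2, h⟩, zero_add]
  | succ n ih =>
    intro z C hz
    rcases le_or_gt k z with h | h
    · rw [exitRight_of_le h]
      linarith [avoid_le_one ω l (n + 1) z C, stayInside_nonneg ω l k (n + 1) z C]
    rcases hz.eq_or_lt with rfl | h2
    · rw [avoid_self]
      exact add_nonneg (exitRight_nonneg _ _ _ _ _ _) (stayInside_nonneg _ _ _ _ _ _)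
    · rw [avoid_succ h2.ne', exitRight_succ h2 h, stayInside_succ h2 h]
      refine (average_le_average _ _ _ (ih (by omega)) (ih (by omega))).trans_eq ?_
      ring

lemma escape_le_cross (ω : Environment) (x k : ℤ) : escape ω x ≤ cross ω x k := by
  have h1 := tendsto_avoid ω (x - 1) x ∅
  have h2 := (tendsto_exitRight ω x k).add (tendsto_stayInside ω (x - 1) k x ∅)
  rw [add_zero] at h2
  exact le_of_tendsto_of_tendsto' h1 h2 fun n => avoid_le_exitRight_add n (by omega)

/-- Leaving through `k` takes at least `k - z` steps, so on this event `l` is not visited up to any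
time `j ≤ k - z`. This bounds `cross` from above by a finite-time avoidance probability. -/
lemma exitRight_le_avoid {l k : ℤ} (hlk : l < k) (j : ℕ) :
    ∀ (n : ℕ) (z : ℤ) (C : Set ℤ), z + j ≤ k → exitRight ω l k n z C ≤ avoid ω l j z C := by
  induction j with
  | zero =>
    intro n z C _
    rcases eq_or_ne z l with rfl | h
    · rw [exitRight_of_le_left hlk le_rfl]; exact avoid_nonneg _ _ _ _ _
    · rw [avoid_zero h]; exact exitRight_le_one _ _ _ _ _ _
  | succ j ih =>
    intro n z C hz
    rcases le_or_gt z l with h | h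
    · rw [exitRight_of_le_left hlk h]; exact avoid_nonneg _ _ _ _ _
    cases n with
    | zero => rw [exitRight_zero (by omega)]; exact avoid_nonneg _ _ _ _ _
    | succ n =>
      rw [exitRight_succ h (by omega), avoid_succ h.ne']
      exact average_le_average _ _ _ (ih _ _ _ (by omega)) (ih _ _ _ (by omega))

lemma tendsto_cross (ω : Environment) :
    Tendsto (fun k : ℕ => cross ω 0 k) atTop (𝓝 (escape ω 0)) :=
  tendsto_of_tendsto_of_tendsto_of_le_of_le tendsto_const_nhds (tendsto_avoid ω (0 - 1) 0 ∅)
    (fun k => escape_le_cross ω 0 k)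
    fun k => ciSup_le fun n => exitRight_le_avoid (by omega) k n 0 ∅ (by omega)

/-! ### Bounds, shift covariance and measurability of crossing and escape -/

lemma escape_nonneg (ω : Environment) (x : ℤ) : 0 ≤ escape ω x := avoidForever_nonneg _ _ _ _

lemma escape_le_one (ω : Environment) (x : ℤ) : escape ω x ≤ 1 := avoidForever_le_one _ _ _ _

lemma cross_shift (ω : Environment) (x k : ℤ) :
    cross (shift ω) x k = cross ω (x + 1) (k + 1) := by
  unfold cross exitRight
  refine congrArg _ (funext fun n => ?_)
  have h := stoppedExp_shift (ω := ω) (S := outside (x + 1 - 1) (k + 1))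
    (f := fun z => if k + 1 ≤ z then 1 else 0) n x ∅
  have hS : (· + 1) ⁻¹' outside (x + 1 - 1) (k + 1) = outside (x - 1) k := by
    ext z; simp only [outside, Set.mem_preimage, Set.mem_ofPred_eq]; omega
  rw [← h, hS]
  simp

lemma escape_shift (ω : Environment) (x : ℤ) : escape (shift ω) x = escape ω (x + 1) := by
  unfold escape avoidForever avoid
  refine congrArg _ (funext fun n => ?_)
  have h := stoppedExp_shift (ω := ω) (S := {x + 1 - 1})
    (f := fun z => if z = x + 1 - 1 then 0 else 1) n x ∅
  have hS : (· + 1) ⁻¹' ({x + 1 - 1} : Set ℤ) = {x - 1} := by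
    ext z; simp only [Set.mem_preimage, Set.mem_singleton_iff]; omega
  have hf : ∀ z : ℤ, (z + 1 = x + 1 - 1) = (z = x - 1) := fun z => by
    simp only [eq_iff_iff]; omega
  rw [← h, hS]
  simp only [hf, Set.preimage_empty]

lemma cross_shift_iterate (ω : Environment) (n : ℕ) (x k : ℤ) :
    cross (shift^[n] ω) x k = cross ω (x + n) (k + n) := by
  induction n generalizing ω with
  | zero => simp
  | succ n ih =>
    rw [Function.iterate_succ_apply, ih, cross_shift]
    push_cast
    congr 1 <;> ring

lemma escape_shift_iterate (ω : Environment) (n : ℕ) (x : ℤ) :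
    escape (shift^[n] ω) x = escape ω (x + n) := by
  induction n generalizing ω with
  | zero => simp
  | succ n ih =>
    rw [Function.iterate_succ_apply, ih, escape_shift]
    push_cast
    congr 1; ring

lemma shift_iterate_apply (ω : Environment) (n : ℕ) (x : ℤ) :
    shift^[n] ω x = ω (x + n) := by
  induction n generalizing ω with
  | zero => simp
  | succ n ih =>
    rw [Function.iterate_succ_apply, ih, shift]
    push_cast
    congr 1; ring

lemma measurable_cross (x k : ℤ) : Measurable fun ω => cross ω x k :=
  measurable_of_tendsto_metrizable
    (fun n => measurable_stoppedExp _ _ n x ∅)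
    (tendsto_pi_nhds.2 fun ω => tendsto_exitRight ω x k)

lemma measurable_escape (x : ℤ) : Measurable fun ω => escape ω x :=
  measurable_of_tendsto_metrizable
    (fun n => measurable_stoppedExp _ _ n x ∅)
    (tendsto_pi_nhds.2 fun ω => tendsto_avoid ω (x - 1) x ∅)

/-- If the walk may escape from `x + 1`, then it may escape from `x`. -/
lemma half_mul_escape_le (ω : Environment) (x : ℤ) :
    1 / 2 * escape ω (x + 1) ≤ escape ω x := by
  refine le_trans ?_ (half_mul_avoidForever_le (by omega) ∅)
  have := avoidForever_mono_target (ω := ω) (C := ∅) (show x - 1 ≤ x + 1 - 1 by omega)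
    (show x + 1 - 1 ≤ x + 1 by omega)
  unfold escape
  linarith

/-- Sites to the right are always reached. For sites to the left, vanishing spreads rightwards from
`x + 1` by `half_mul_avoidForever_le`, and finitely many consumed cookies cost only a finite factor.
-/
lemma avoidForever_eq_zero (h : ∀ x, escape ω x = 0) (x z : ℤ) {C : Set ℤ} (hC : C.Finite) :
    avoidForever ω x z C = 0 := by
  rcases le_or_gt z x with hz | hz
  · exact avoidForever_eq_zero_of_le hz C
  refine avoidForever_eq_zero_of_finite ?_ hC
  obtain ⟨n, rfl⟩ : ∃ n : ℕ, z = x + 1 + n := ⟨(z - x - 1).toNat, by omega⟩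
  clear hz
  induction n with
  | zero => simpa [escape] using h (x + 1)
  | succ n ih =>
    have h1 := half_mul_avoidForever_le (ω := ω) (x := x) (z := x + 1 + n) (by omega) ∅
    rw [ih] at h1
    push_cast
    rw [← add_assoc]
    linarith [avoidForever_nonneg ω x (x + 1 + n + 1) ∅]

/-! ### The balance equation -/

/-- The total drift stored in the cookie at site `x`. -/
noncomputable def drift (ω : Environment) (x : ℤ) : ℝ := (ω x : ℝ) / (1 - ω x) - 1

lemma drift_nonneg (ω : Environment) (x : ℤ) : 0 ≤ drift ω x := by
  have h0 := (ω x).2.1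
  have h1 := (ω x).2.2
  rw [drift, sub_nonneg, le_div_iff₀ (by linarith)]
  linarith

lemma one_sub_mul_drift (ω : Environment) (x : ℤ) :
    (1 - (ω x : ℝ)) * drift ω x = 2 * ω x - 1 := by
  have h1 := (ω x).2.2
  rw [drift]
  field_simp [show (1 - (ω x : ℝ)) ≠ 0 by linarith]
  ring

lemma drift_shift_iterate (ω : Environment) (n : ℕ) (x : ℤ) :
    drift (shift^[n] ω) x = drift ω (x + n) := by
  simp only [drift, shift_iterate_apply]

lemma measurable_drift (x : ℤ) : Measurable fun ω => drift ω x := by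
  have : Measurable fun ω : Environment => (ω x : ℝ) :=
    measurable_subtype_coe.comp (measurable_pi_apply x)
  exact (this.div (measurable_const.sub this)).sub measurable_const

/-- The probability that the chain started at `(z, C)` consumes the cookie at `x` by time `n` and
before leaving `(-1, k)`. -/
noncomputable def consumption (ω : Environment) (k x : ℤ) (n : ℕ) (z : ℤ) (C : Set ℤ) : ℝ :=
  stoppedExp ω (outside (-1) k) (fun _ C => C.indicator 1 x) n z C

/-- Optional stopping for the position minus the total drift of the consumed cookies: the mean step
2ω - 1 at a fresh site equals the consumption probability 1 - ω times the drift. -/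
lemma sum_drift_mul_consumption (k n : ℕ) :
    ∑ x ∈ Finset.range k, drift ω x * consumption ω k x n 0 ∅ =
      stoppedExp ω (outside (-1) k) (fun z _ => (z : ℝ)) n 0 ∅ := by
  have key : stoppedExp ω (outside (-1) k) (fun z C => (z : ℝ) +
      (-1) * ∑ x ∈ Finset.range k, drift ω x * C.indicator 1 (x : ℤ)) n 0 ∅ = 0 := by
    rw [stoppedExp_eq_of_harmonic]
    · simp
    · intro z C hz
      have hz := notMem_outside.1 hz
      by_cases hC : z ∈ C
      · rw [rightWeight_of_mem hC, Set.insert_eq_of_mem hC]; push_cast; ring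
      · lift z to ℕ using by omega
        have hs : ∑ x ∈ Finset.range k, drift ω x * (insert (z : ℤ) C).indicator 1 (x : ℤ) =
            ∑ x ∈ Finset.range k, drift ω x * C.indicator 1 (x : ℤ) + drift ω z := by
          have : drift ω z = ∑ x ∈ Finset.range k, if x = z then drift ω x else 0 := by
            rw [Finset.sum_ite_eq', if_pos (Finset.mem_range.2 (by omega))]
          rw [this, ← Finset.sum_add_distrib]
          refine Finset.sum_congr rfl fun x _ => ?_
          by_cases hxz : x = z
          · subst hxz; simp [hC]
          · have : (insert (z : ℤ) C).indicator (1 : ℤ → ℝ) x = C.indicator 1 (x : ℤ) := by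
              by_cases hxC : (x : ℤ) ∈ C <;> simp [hxC, hxz]
            rw [this, if_neg hxz, add_zero]
        rw [rightWeight_of_notMem hC, hs]
        have := one_sub_mul_drift ω z
        push_cast
        linear_combination -this
  rw [stoppedExp_add, stoppedExp_const_mul, stoppedExp_sum] at key
  simp only [stoppedExp_const_mul] at key
  unfold consumption
  linarith

/-- The stopped position is -1 on a left exit and at most `k` otherwise. -/
lemma stoppedExp_position_le (k n : ℕ) :
    stoppedExp ω (outside (-1) k) (fun z _ => (z : ℝ)) n 0 ∅ ≤
      (k + 1) * (exitRight ω (-1) k n 0 ∅ + stayInside ω (-1) k n 0 ∅) - 1 := by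
  rw [exitRight, stayInside, ← stoppedExp_add, ← stoppedExp_const_mul, sub_eq_add_neg,
    ← stoppedExp_const (ω := ω) (S := outside (-1) k) (-1) n 0 ∅, ← stoppedExp_add]
  refine stoppedExp_mono_on (I := fun z _ => -1 ≤ z ∧ z ≤ k) ?_ ?_ n (by omega)
  · intro z C hz _
    have := notMem_outside.1 hz
    omega
  · rintro z C ⟨h1, h2⟩
    have h1' : (-1 : ℝ) ≤ z := by exact_mod_cast h1
    have h2' : (z : ℝ) ≤ k := by exact_mod_cast h2
    split_ifs with h3 h4 h5
    · omega
    · linarith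
    · linarith
    · have : z = -1 := by omega
      subst this; simp

lemma le_stoppedExp_position (k n : ℕ) :
    (k + 1) * exitRight ω (-1) k n 0 ∅ - 1 ≤
      stoppedExp ω (outside (-1) k) (fun z _ => (z : ℝ)) n 0 ∅ := by
  rw [exitRight, ← stoppedExp_const_mul, sub_eq_add_neg,
    ← stoppedExp_const (ω := ω) (S := outside (-1) k) (-1) n 0 ∅, ← stoppedExp_add]
  refine stoppedExp_mono_on (I := fun z _ => -1 ≤ z ∧ z ≤ k) ?_ ?_ n (by omega)
  · intro z C hz _
    have := notMem_outside.1 hz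
    omega
  · rintro z C ⟨h1, h2⟩
    have h1' : (-1 : ℝ) ≤ z := by exact_mod_cast h1
    split_ifs with h3
    · have : (k : ℝ) ≤ z := by exact_mod_cast h3
      linarith
    · linarith

lemma consumption_succ {k z : ℤ} (h₁ : -1 < z) (h₂ : z < k) (x : ℤ) (n : ℕ) (C : Set ℤ) :
    consumption ω k x (n + 1) z C = rightWeight ω C z * consumption ω k x n (z + 1) C +
        (1 - rightWeight ω C z) * consumption ω k x n (z - 1) (insert z C) :=
  stoppedExp_succ (notMem_outside.2 ⟨h₁, h₂⟩) n C

lemma consumption_zero {x : ℤ} {C : Set ℤ} (h : x ∉ C) (k z : ℤ) :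
    consumption ω k x 0 z C = 0 := by
  simp [consumption, h]

lemma consumption_of_outside {k x z : ℤ} {C : Set ℤ} (h : x ∉ C) (hz : z ≤ -1 ∨ k ≤ z) (n : ℕ) :
    consumption ω k x n z C = 0 := by
  rw [consumption, stoppedExp_of_mem hz, Set.indicator_of_notMem h]

lemma consumption_of_mem {k x : ℤ} (n : ℕ) :
    ∀ {z : ℤ} {C : Set ℤ}, x ∈ C → consumption ω k x n z C = 1 := by
  induction n with
  | zero => intro z C h; simp [consumption, h]
  | succ n ih =>
    intro z C h
    by_cases hz : z ∈ outside (-1) k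
    · rw [consumption, stoppedExp_of_mem hz, Set.indicator_of_mem h, Pi.one_apply]
    · have := notMem_outside.1 hz
      rw [consumption_succ this.1 this.2, ih h, ih (Set.mem_insert_of_mem z h)]
      ring

lemma consumption_nonneg (ω : Environment) (k x : ℤ) (n : ℕ) (z : ℤ) (C : Set ℤ) :
    0 ≤ consumption ω k x n z C := by
  rw [← stoppedExp_const (ω := ω) (S := outside (-1) k) 0 n z C]
  exact stoppedExp_mono (fun z C => Set.indicator_nonneg (by simp) x) _ _ _

/-- Starting to the right of `x`, the cookie at `x` is consumed exactly upon reaching `x - 1`. -/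
lemma consumption_eq_exitLeft {k x : ℤ} (hx : 0 ≤ x) (n : ℕ) :
    ∀ {z : ℤ} {C : Set ℤ}, x ≤ z → x ∉ C →
      consumption ω k x n z C = exitLeft ω (x - 1) k n z C := by
  induction n with
  | zero =>
    intro z C hz hC
    rw [consumption_zero hC, exitLeft, stoppedExp_zero, if_neg (by omega)]
  | succ n ih =>
    intro z C hz hC
    rcases le_or_gt k z with hk | hk
    · rw [consumption_of_outside hC (Or.inr hk), exitLeft, stoppedExp_of_mem (Or.inr hk),
        if_neg (by omega)]
    · rw [consumption_succ (by omega) hk, exitLeft_succ (by omega) hk, ih (by omega) hC]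
      rcases hz.eq_or_lt with rfl | hlt
      · rw [consumption_of_mem n (Set.mem_insert x C), exitLeft, exitLeft,
          stoppedExp_of_mem (z := x - 1) (Or.inl le_rfl), if_pos le_rfl]
      · rw [ih (by omega) (by simp [hC, hlt.ne])]

lemma consumption_self {k x : ℤ} (hx : 0 ≤ x) (n : ℕ) {C : Set ℤ} (hC : ∀ y, x ≤ y → y ∉ C) :
    consumption ω k x n x C = exitLeft ω (x - 1) k n x ∅ := by
  rw [consumption_eq_exitLeft hx n le_rfl (hC x le_rfl), exitLeft_congr_consumed hC]

lemma notMem_insert_of_lt {x z : ℤ} {C : Set ℤ} (hz : z < x) (hC : ∀ y, x ≤ y → y ∉ C) :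
    ∀ y, x ≤ y → y ∉ insert z C := fun y hy h => by
  rcases Set.mem_insert_iff.1 h with rfl | h
  · omega
  · exact hC y hy h

/-- Markov property at the first visit to `x`: the cookies from `x` onwards are then untouched, and
the one at `x` is consumed exactly if `x - 1` is reached before `k`. -/
lemma consumption_le {k x : ℤ} (hx : 0 ≤ x) (hxk : x < k) (n : ℕ) :
    ∀ {z : ℤ} {C : Set ℤ}, z ≤ x → (∀ y, x ≤ y → y ∉ C) →
      consumption ω k x n z C ≤ exitRight ω (-1) x n z C * (1 - cross ω x k) := by
  have hc : 0 ≤ 1 - cross ω x k := sub_nonneg.2 (cross_le_one ω x k)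
  induction n with
  | zero =>
    intro z C hz hC
    rw [consumption_zero (hC x le_rfl)]
    exact mul_nonneg (exitRight_nonneg _ _ _ _ _ _) hc
  | succ n ih =>
    intro z C hz hC
    rcases hz.eq_or_lt with rfl | hlt
    · rw [exitRight_of_le le_rfl, one_mul, consumption_self hx _ hC]
      exact exitLeft_le ω (by omega) _
    rcases le_or_gt z (-1) with h | h
    · rw [consumption_of_outside (hC x le_rfl) (Or.inl h)]
      exact mul_nonneg (exitRight_nonneg _ _ _ _ _ _) hc
    · rw [consumption_succ h (by omega), exitRight_succ h hlt]
      refine (average_le_average _ _ _ (ih (by omega) hC)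
        (ih (by omega) (notMem_insert_of_lt hlt hC))).trans_eq ?_
      ring

/-- The same factorization from below: `n` steps are allowed for reaching `x` and `m` further steps
for consuming its cookie. -/
lemma le_consumption {k x : ℤ} (hx : 0 ≤ x) (hxk : x < k) (m n : ℕ) :
    ∀ {z : ℤ} {C : Set ℤ}, z ≤ x → (∀ y, x ≤ y → y ∉ C) →
      exitRight ω (-1) x n z C * exitLeft ω (x - 1) k m x ∅ ≤ consumption ω k x (m + n) z C := by
  induction n with
  | zero =>
    intro z C hz hC
    rcases hz.eq_or_lt with rfl | hlt
    · rw [exitRight_of_le le_rfl, one_mul, add_zero, consumption_self hx _ hC]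
    · rw [exitRight_zero hlt, zero_mul]
      exact consumption_nonneg _ _ _ _ _ _
  | succ n ih =>
    intro z C hz hC
    rcases hz.eq_or_lt with rfl | hlt
    · rw [exitRight_of_le le_rfl, one_mul, consumption_self hx _ hC]
      exact monotone_exitLeft ω _ _ _ _ (by omega)
    rcases le_or_gt z (-1) with h | h
    · rw [exitRight_of_le_left (by omega) h, zero_mul]
      exact consumption_nonneg _ _ _ _ _ _
    · rw [← add_assoc, consumption_succ h (by omega), exitRight_succ h hlt]
      refine le_trans (le_of_eq ?_) (average_le_average _ _ _ (ih (by omega) hC)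
        (ih (by omega) (notMem_insert_of_lt hlt hC)))
      ring

lemma mul_cross_le (ω : Environment) (k : ℕ) :
    (k + 1) * cross ω 0 k ≤
      1 + ∑ x ∈ Finset.range k, drift ω x * (cross ω 0 x * (1 - cross ω x k)) := by
  refine le_of_tendsto' ((tendsto_exitRight ω 0 k).const_mul _) fun n => ?_
  have h1 := le_stoppedExp_position (ω := ω) k n
  rw [← sum_drift_mul_consumption] at h1
  have h2 : ∑ x ∈ Finset.range k, drift ω x * consumption ω k x n 0 ∅ ≤
      ∑ x ∈ Finset.range k, drift ω x * (cross ω 0 x * (1 - cross ω x k)) := by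
    refine Finset.sum_le_sum fun x hx => mul_le_mul_of_nonneg_left ?_ (drift_nonneg _ _)
    have hx := Finset.mem_range.1 hx
    refine (consumption_le (by omega) (by omega) n (by omega) (by simp)).trans ?_
    exact mul_le_mul_of_nonneg_right (exitRight_le_cross ω 0 x n)
      (sub_nonneg.2 (cross_le_one ω x k))
  rw [zero_sub]
  linarith

lemma le_mul_cross (ω : Environment) (k : ℕ) :
    1 + ∑ x ∈ Finset.range k, drift ω x * (cross ω 0 x * (1 - cross ω x k)) ≤
      (k + 1) * cross ω 0 k := by
  have hl : Tendsto (fun n => 1 + ∑ x ∈ Finset.range k, drift ω x *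
      (exitRight ω (0 - 1) x n 0 ∅ * exitLeft ω (x - 1) k n x ∅)) atTop
      (𝓝 (1 + ∑ x ∈ Finset.range k, drift ω x * (cross ω 0 x * (1 - cross ω x k)))) := by
    refine tendsto_const_nhds.add (tendsto_finsetSum _ fun x hx => ?_)
    have hx := Finset.mem_range.1 hx
    exact ((tendsto_exitRight ω 0 x).mul (tendsto_exitLeft ω (by omega))).const_mul _
  -- The right side is taken at time `n + n`, the time budget of `le_consumption` with `m = n`.
  have hr := (((tendsto_exitRight ω 0 k).add (tendsto_stayInside ω (0 - 1) k 0 ∅)).const_mul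
    ((k : ℝ) + 1)).comp (tendsto_atTop_mono (fun n => Nat.le_add_left n n) tendsto_id)
  rw [add_zero] at hr
  refine le_of_tendsto_of_tendsto' hl hr fun n => ?_
  have h1 := stoppedExp_position_le (ω := ω) k (n + n)
  rw [← sum_drift_mul_consumption] at h1
  have h2 : ∑ x ∈ Finset.range k, drift ω x *
        (exitRight ω (-1) x n 0 ∅ * exitLeft ω (x - 1) k n x ∅) ≤
      ∑ x ∈ Finset.range k, drift ω x * consumption ω k x (n + n) 0 ∅ := by
    refine Finset.sum_le_sum fun x hx => mul_le_mul_of_nonneg_left ?_ (drift_nonneg _ _)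
    have hx := Finset.mem_range.1 hx
    exact le_consumption (by omega) (by omega) n n (by omega) (by simp)
  simp only [zero_sub, Function.comp_apply]
  linarith

/-! ### Averages along the orbits of a measure-preserving map -/

section Averages

variable {Ω : Type*} [MeasurableSpace Ω] {μ : Measure Ω} {T : Ω → Ω} {g : Ω → ℝ}

lemma measurable_orbit_average (hT : MeasurePreserving T μ μ) (hg : Measurable g) (k : ℕ) :
    Measurable fun ω => (∑ i ∈ Finset.range k, ENNReal.ofReal (g (T^[i] ω))) / (k : ENNReal) :=
  (Finset.measurable_sum _ fun i _ =>
    (hg.comp (hT.measurable.iterate i)).ennreal_ofReal).div_const _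

lemma tendsto_lintegral_orbit_average (hT : MeasurePreserving T μ μ) (hg : Measurable g) :
    Tendsto (fun k : ℕ => ∫⁻ ω, (∑ i ∈ Finset.range k, ENNReal.ofReal (g (T^[i] ω))) / k ∂μ) atTop
      (𝓝 (∫⁻ ω, ENNReal.ofReal (g ω) ∂μ)) := by
  refine tendsto_const_nhds.congr' ?_
  filter_upwards [eventually_ge_atTop 1] with k hk
  have hi : ∀ i, ∫⁻ ω, ENNReal.ofReal (g (T^[i] ω)) ∂μ = ∫⁻ ω, ENNReal.ofReal (g ω) ∂μ :=
    fun i => (hT.iterate i).lintegral_comp hg.ennreal_ofReal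
  have hm : ∀ i, Measurable fun ω => ENNReal.ofReal (g (T^[i] ω)) :=
    fun i => (hg.comp (hT.measurable.iterate i)).ennreal_ofReal
  simp only [div_eq_mul_inv]
  rw [lintegral_mul_const _ (Finset.measurable_sum _ fun i _ => hm i),
    lintegral_finsetSum _ fun i _ => hm i]
  simp only [hi, Finset.sum_const, Finset.card_range, nsmul_eq_mul]
  rw [mul_comm, ← mul_assoc, ENNReal.inv_mul_cancel (by simp; omega) (by simp), one_mul]

lemma orbit_average_eq_ofReal {Ω : Type*} {T : Ω → Ω} {g : Ω → ℝ} (hg0 : ∀ ω, 0 ≤ g ω) {k : ℕ} (hk : 0 < k) (ω : Ω) :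
    (∑ i ∈ Finset.range k, ENNReal.ofReal (g (T^[i] ω))) / k =
      ENNReal.ofReal ((∑ i ∈ Finset.range k, g (T^[i] ω)) / k) := by
  rw [← ENNReal.ofReal_sum_of_nonneg fun i _ => hg0 _, ENNReal.ofReal_div_of_pos (by positivity),
    ENNReal.ofReal_natCast]

/-- If `∫ g < 1`, then orbit averages of `g` are infinitely often bounded away from `1`, with
positive probability. -/
lemma frequently_sum_le_of_lintegral_lt_one [IsProbabilityMeasure μ] (hT : MeasurePreserving T μ μ)
    (hg : Measurable g) (hg0 : ∀ ω, 0 ≤ g ω) (h : ∫⁻ ω, ENNReal.ofReal (g ω) ∂μ < 1) :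
    ∃ᵐ ω ∂μ, ∃ c < (1 : ℝ), 0 ≤ c ∧
      ∃ᶠ k : ℕ in atTop, ∑ i ∈ Finset.range k, g (T^[i] ω) ≤ c * k := by
  have hF := lintegral_liminf_le (μ := μ) (u := atTop) fun k => measurable_orbit_average hT hg k
  rw [(tendsto_lintegral_orbit_average hT hg).liminf_eq] at hF
  have hfreq : ∃ᵐ ω ∂μ, liminf (fun k : ℕ =>
      (∑ i ∈ Finset.range k, ENNReal.ofReal (g (T^[i] ω))) / (k : ENNReal)) atTop < 1 := by
    intro hn
    refine absurd (hF.trans_lt h) (not_lt.2 ?_)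
    calc (1 : ENNReal) = ∫⁻ _, 1 ∂μ := by simp
      _ ≤ _ := lintegral_mono_ae (hn.mono fun ω hω => not_lt.1 hω)
  refine hfreq.mono fun ω hω => ?_
  obtain ⟨c, hc1, hc2⟩ := exists_between hω
  refine ⟨c.toReal, ?_, ENNReal.toReal_nonneg, ?_⟩
  · simpa using (ENNReal.toReal_lt_toReal hc2.ne_top ENNReal.one_ne_top).2 hc2
  · have := frequently_lt_of_liminf_lt (by isBoundedDefault) hc1
    refine (this.and_eventually (eventually_gt_atTop 0)).mono ?_
    rintro k ⟨hk, hk0⟩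
    have hk0' : (0 : ℝ) < k := by exact_mod_cast hk0
    rw [orbit_average_eq_ofReal hg0 hk0, ENNReal.ofReal_lt_iff_lt_toReal
      (div_nonneg (Finset.sum_nonneg fun i _ => hg0 _) hk0'.le) hc2.ne_top,
      div_lt_iff₀ hk0'] at hk
    exact hk.le

/-- If `g` is bounded and `∫ g > 1`, then orbit averages of `g` are infinitely often bounded away
from `1`, with positive probability. -/
lemma frequently_le_sum_of_one_lt_lintegral [IsProbabilityMeasure μ] (hT : MeasurePreserving T μ μ)
    (hg : Measurable g) (hg0 : ∀ ω, 0 ≤ g ω) {K : ℝ} (hK : ∀ ω, g ω ≤ K)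
    (h : 1 < ∫⁻ ω, ENNReal.ofReal (g ω) ∂μ) :
    ∃ᵐ ω ∂μ, ∃ c > (1 : ℝ), ∃ᶠ k : ℕ in atTop, c * k ≤ ∑ i ∈ Finset.range k, g (T^[i] ω) := by
  have hF := limsup_lintegral_le (μ := μ) (fun _ => ENNReal.ofReal K)
    (fun k => measurable_orbit_average hT hg k) (fun k => ae_of_all _ fun ω => by
      -- At `k = 0` the average is 0/0 = 0 in `ENNReal`.
      rcases k.eq_zero_or_pos with rfl | hk
      · simp
      have hk' : (0 : ℝ) < k := by exact_mod_cast hk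
      dsimp only
      rw [orbit_average_eq_ofReal hg0 hk]
      refine ENNReal.ofReal_le_ofReal ?_
      rw [div_le_iff₀ hk']
      refine (Finset.sum_le_sum fun i _ => hK _).trans_eq ?_
      simp [mul_comm]) (by simp)
  rw [(tendsto_lintegral_orbit_average hT hg).limsup_eq] at hF
  have hfreq : ∃ᵐ ω ∂μ, 1 < limsup (fun k : ℕ =>
      (∑ i ∈ Finset.range k, ENNReal.ofReal (g (T^[i] ω))) / (k : ENNReal)) atTop := by
    intro hn
    refine absurd (h.trans_le hF) (not_lt.2 ?_)
    calc _ ≤ ∫⁻ _, 1 ∂μ := lintegral_mono_ae (hn.mono fun ω hω => not_lt.1 hω)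
      _ = 1 := by simp
  refine hfreq.mono fun ω hω => ?_
  obtain ⟨c, hc1, hc2⟩ := exists_between hω
  have hct : c ≠ ⊤ := (hc2.trans_le le_top).ne
  refine ⟨c.toReal, ?_, ?_⟩
  · simpa using (ENNReal.toReal_lt_toReal ENNReal.one_ne_top hct).2 hc1
  · have := frequently_lt_of_lt_limsup (by isBoundedDefault) hc2
    refine (this.and_eventually (eventually_gt_atTop 0)).mono ?_
    rintro k ⟨hk, hk0⟩
    have hk0' : (0 : ℝ) < k := by exact_mod_cast hk0
    rw [orbit_average_eq_ofReal hg0 hk0, ENNReal.lt_ofReal_iff_toReal_lt hct,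
      lt_div_iff₀ hk0'] at hk
    exact hk.le

end Averages

/-! ### The escape probability and the mean drift -/

variable {μ : Measure Environment} [IsProbabilityMeasure μ]

/-- By `half_mul_escape_le` the event of positive escape contains its preimage under the shift, so
ergodicity makes it trivial. -/
lemma ae_escape_dichotomy (hμ : Ergodic shift μ) :
    (∀ᵐ ω ∂μ, escape ω 0 = 0) ∨ ∀ᵐ ω ∂μ, 0 < escape ω 0 := by
  have hm : MeasurableSet {ω : Environment | 0 < escape ω 0} :=
    measurableSet_lt measurable_const (measurable_escape 0)
  have hsub : shift ⁻¹' {ω : Environment | 0 < escape ω 0} ⊆ {ω | 0 < escape ω 0} := by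
    intro ω hω
    have h1 : 0 < escape ω (0 + 1) := by rw [← escape_shift]; exact hω
    have h2 := half_mul_escape_le ω 0
    exact lt_of_lt_of_le (mul_pos one_half_pos h1) h2
  rcases hμ.ae_empty_or_univ_of_preimage_ae_le hm.nullMeasurableSet
    (LE.le.eventuallyLE hsub) with h | h
  · left
    rw [ae_eq_empty] at h
    have : ∀ᵐ ω ∂μ, ¬ 0 < escape ω 0 := by
      rw [ae_iff]; simpa using h
    exact this.mono fun ω hω => le_antisymm (not_lt.1 hω) (escape_nonneg ω 0)
  · right
    rw [ae_eq_univ] at h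
    rwa [ae_iff]

/-- By stationarity all the events `p x` have equal measure. Comparing measures also reaches
negative sites, although only the forward shift is at hand. -/
lemma ae_forall_int {p : ℤ → Environment → Prop} (hμ : MeasurePreserving shift μ μ)
    (hp : ∀ x, MeasurableSet {ω | p x ω}) (hs : ∀ x ω, p x (shift ω) ↔ p (x + 1) ω)
    (h : ∀ᵐ ω ∂μ, p 0 ω) : ∀ᵐ ω ∂μ, ∀ x, p x ω := by
  have hstep : ∀ x, μ {ω | p (x + 1) ω} = μ {ω | p x ω} := by
    intro x
    rw [← hμ.measure_preimage (hp x).nullMeasurableSet]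
    congr 1
    ext ω
    exact (hs x ω).symm
  have hall : ∀ x, μ {ω | p x ω} = μ {ω | p 0 ω} := by
    intro x
    induction x using Int.induction_on with
    | zero => rfl
    | succ n ih => rw [hstep, ih]
    | pred n ih => rw [← hstep, sub_add_cancel, ih]
  rw [ae_all_iff]
  intro x
  have h1 : ∀ x, (∀ᵐ ω ∂μ, p x ω) ↔ μ {ω | p x ω} = 1 := fun x => prob_compl_eq_zero_iff (hp x)
  rw [h1, hall, ← h1]
  exact h

/-- For large `x` the factor `cross ω 0 x` is close to `q = escape ω 0`, so `mul_cross_le` divided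
by `k` would give roughly q ≤ q c, impossible for `c < 1`. -/
lemma not_frequently_sum_le {ω : Environment} (h : 0 < escape ω 0) {c : ℝ} (hc : c < 1)
    (hc0 : 0 ≤ c) :
    ¬ ∃ᶠ k : ℕ in atTop, ∑ x ∈ Finset.range k, drift ω x * (1 - escape ω x) ≤ c * k := by
  intro hf
  set q := escape ω 0 with hq
  set g : ℕ → ℝ := fun x => drift ω x * (1 - escape ω x) with hg
  have hg0 : ∀ x, 0 ≤ g x := fun x =>
    mul_nonneg (drift_nonneg _ _) (sub_nonneg.2 (escape_le_one _ _))
  -- `r` is an upper bound for `cross ω 0 x` once `x ≥ n`, still small enough that `r * c < q`; the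
  -- finitely many earlier terms are absorbed by taking `k` large.
  obtain ⟨r, hr1, hr2⟩ : ∃ r, q < r ∧ r * c < q := by
    rcases hc0.eq_or_lt with rfl | hc0
    · exact ⟨q + 1, by linarith, by simpa using h⟩
    · have : q < q / c := by rw [lt_div_iff₀ hc0]; nlinarith
      obtain ⟨r, h1, h2⟩ := exists_between this
      exact ⟨r, h1, (lt_div_iff₀ hc0).1 h2⟩
  obtain ⟨n, hn⟩ : ∃ n : ℕ, cross ω 0 n < r :=
    ((tendsto_cross ω).eventually_lt_const hr1).exists
  have hlarge : ∀ᶠ k : ℕ in atTop, 1 + ∑ x ∈ Finset.range n, g x < (q - r * c) * k := by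
    refine (tendsto_natCast_atTop_atTop.const_mul_atTop (sub_pos.2 hr2)).eventually_gt_atTop _
  obtain ⟨k, ⟨hk1, hk2⟩, hk3⟩ :=
    ((hf.and_eventually hlarge).and_eventually (eventually_ge_atTop n)).exists
  have h1 := mul_cross_le ω k
  have h2 : ∑ x ∈ Finset.range k, drift ω x * (cross ω 0 x * (1 - cross ω x k)) ≤
      ∑ x ∈ Finset.range k, ((if x < n then g x else 0) + r * g x) := by
    refine Finset.sum_le_sum fun x _ => ?_
    have hA : drift ω x * (cross ω 0 x * (1 - cross ω x k)) ≤ cross ω 0 x * g x := by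
      have : drift ω x * (cross ω 0 x * (1 - cross ω x k)) ≤
          drift ω x * (cross ω 0 x * (1 - escape ω x)) := by
        gcongr
        · exact drift_nonneg _ _
        · exact cross_nonneg _ _ _
        · exact escape_le_cross _ _ _
      refine this.trans_eq ?_
      rw [hg]; ring
    refine hA.trans ?_
    split_ifs with hxn
    · have := cross_le_one ω 0 x
      nlinarith [hg0 x, h.trans hr1]
    · rw [zero_add]
      exact mul_le_mul_of_nonneg_right ((antitone_cross ω (not_lt.1 hxn)).trans hn.le) (hg0 x)
  rw [Finset.sum_add_distrib, ← Finset.mul_sum, ← Finset.sum_filter] at h2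
  have h3 : (Finset.range k).filter (· < n) = Finset.range n := by
    ext x; simp only [Finset.mem_filter, Finset.mem_range]; omega
  rw [h3] at h2
  have h4 : q * (k + 1) ≤ (k + 1) * cross ω 0 k := by
    rw [mul_comm]
    exact mul_le_mul_of_nonneg_left (escape_le_cross ω 0 k) (by positivity)
  have h5 : r * ∑ x ∈ Finset.range k, g x ≤ r * (c * k) :=
    mul_le_mul_of_nonneg_left hk1 (h.trans hr1).le
  nlinarith

lemma cross_anti (ω : Environment) (x : ℕ) {m n : ℕ} (h : m ≤ n) :
    cross ω x (x + n) ≤ cross ω x (x + m) := by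
  have := antitone_cross (shift^[x] ω) h
  simpa only [cross_shift_iterate, zero_add, add_comm (x : ℤ)] using this

/-- For `x ≤ k - M` one has c(0,x) ≥ c(0,k) and c(x,k) ≤ c(x,x+M), so `le_mul_cross` bounds 1 +
c(0,k) times the truncated sum over x < k - M by (k + 1) c(0,k). That sum is therefore less than k +
1. -/
lemma not_frequently_le_sum {ω : Environment} (M : ℕ) {c : ℝ} (hc : 1 < c) :
    ¬ ∃ᶠ k : ℕ in atTop,
      c * k ≤ ∑ x ∈ Finset.range k, min (drift ω x) M * (1 - cross ω x (x + M)) := by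
  intro hf
  set g : ℕ → ℝ := fun x => min (drift ω x) M * (1 - cross ω x (x + M)) with hg
  have hgM : ∀ x, g x ≤ M := fun x => by
    have h1 : min (drift ω x) M ≤ M := min_le_right _ _
    have h2 : 0 ≤ min (drift ω x) (M : ℝ) := le_min (drift_nonneg _ _) M.cast_nonneg
    exact (mul_le_of_le_one_right h2 (by linarith [cross_nonneg ω x (x + M)])).trans h1
  -- The last `M` terms, each at most `M`, are discarded at a cost of `M * M`.
  have hlarge : ∀ᶠ k : ℕ in atTop, (M : ℝ) * M + 1 < (c - 1) * k :=
    (tendsto_natCast_atTop_atTop.const_mul_atTop (sub_pos.2 hc)).eventually_gt_atTop _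
  obtain ⟨k, ⟨hk1, hk2⟩, hk3⟩ :=
    ((hf.and_eventually hlarge).and_eventually (eventually_ge_atTop M)).exists
  obtain ⟨j, rfl⟩ : ∃ j, k = j + M := ⟨k - M, by omega⟩
  set A := cross ω 0 ((j + M : ℕ) : ℤ) with hA
  have hA0 : 0 ≤ A := cross_nonneg _ _ _
  have h1 := le_mul_cross ω (j + M)
  have h2 : A * ∑ x ∈ Finset.range j, g x ≤ ∑ x ∈ Finset.range (j + M),
      drift ω x * (cross ω 0 x * (1 - cross ω x ((j + M : ℕ) : ℤ))) := by
    rw [Finset.sum_range_add, Finset.mul_sum]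
    refine le_add_of_le_of_nonneg (Finset.sum_le_sum fun x hx => ?_)
      (Finset.sum_nonneg fun x _ => mul_nonneg (drift_nonneg _ _)
        (mul_nonneg (cross_nonneg _ _ _) (sub_nonneg.2 (cross_le_one _ _ _))))
    have hx := Finset.mem_range.1 hx
    have h3 : cross ω x ((j + M : ℕ) : ℤ) ≤ cross ω x (x + M) := by
      have := cross_anti ω x (show M ≤ j + M - x by omega)
      rwa [show ((x : ℤ) + (j + M - x : ℕ)) = ((j + M : ℕ) : ℤ) by omega] at this
    have h4 : A ≤ cross ω 0 x := antitone_cross ω (show x ≤ j + M by omega)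
    have h5 : min (drift ω x) (M : ℝ) ≤ drift ω x := min_le_left _ _
    have h6 : 0 ≤ min (drift ω x) (M : ℝ) := le_min (drift_nonneg _ _) M.cast_nonneg
    have h7 : 0 ≤ 1 - cross ω x (x + M) := sub_nonneg.2 (cross_le_one _ _ _)
    calc A * g x = min (drift ω x) M * (A * (1 - cross ω x (x + M))) := by rw [hg]; ring
      _ ≤ drift ω x * (cross ω 0 x * (1 - cross ω x ((j + M : ℕ) : ℤ))) := by
        gcongr
        · exact h6.trans h5
        · exact cross_nonneg _ _ _
  have h8 : ∑ x ∈ Finset.range (j + M), g x ≤ ∑ x ∈ Finset.range j, g x + M * M := by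
    rw [Finset.sum_range_add]
    have : ∑ x ∈ Finset.range M, g (j + x) ≤ ∑ x ∈ Finset.range M, (M : ℝ) :=
      Finset.sum_le_sum fun x _ => hgM _
    rw [Finset.sum_const, Finset.card_range, nsmul_eq_mul] at this
    linarith
  have h9 : ((j + M : ℕ) : ℝ) + 1 ≤ ∑ x ∈ Finset.range j, g x := by linarith
  have h10 := mul_le_mul_of_nonneg_left h9 hA0
  linarith

lemma ofReal_ratio_eq (ω : Environment) :
    ENNReal.ofReal ((ω 0 : ℝ) / (1 - (ω 0 : ℝ))) = ENNReal.ofReal (drift ω 0) + 1 := by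
  rw [← ENNReal.ofReal_one, ← ENNReal.ofReal_add (drift_nonneg ω 0) zero_le_one, drift,
    sub_add_cancel]

lemma lintegral_ratio_eq (μ : Measure Environment) [IsProbabilityMeasure μ] :
    ∫⁻ ω, ENNReal.ofReal ((ω 0 : ℝ) / (1 - (ω 0 : ℝ))) ∂μ =
      ∫⁻ ω, ENNReal.ofReal (drift ω 0) ∂μ + 1 := by
  simp only [ofReal_ratio_eq]
  rw [lintegral_add_right _ measurable_const]
  simp

/-- If the mean drift per site is at most one, the walk cannot escape. -/
theorem ae_escape_eq_zero (hμ : Ergodic shift μ)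
    (h : ∫⁻ ω, ENNReal.ofReal ((ω 0 : ℝ) / (1 - (ω 0 : ℝ))) ∂μ ≤ 2) :
    ∀ᵐ ω ∂μ, ∀ x, escape ω x = 0 := by
  refine ae_forall_int hμ.toMeasurePreserving
    (fun x => measurable_escape x (measurableSet_singleton 0))
    (fun x ω => by rw [escape_shift]) ?_
  refine (ae_escape_dichotomy hμ).resolve_right fun hpos => ?_
  have hδ : ∫⁻ ω, ENNReal.ofReal (drift ω 0) ∂μ ≤ 1 := by
    rw [lintegral_ratio_eq] at h
    exact (ENNReal.add_le_add_iff_right ENNReal.one_ne_top).1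
      (h.trans_eq one_add_one_eq_two.symm)
  set g : Environment → ℝ := fun ω => drift ω 0 * (1 - escape ω 0) with hg
  have hgm : Measurable g := (measurable_drift 0).mul (measurable_const.sub (measurable_escape 0))
  have hg0 : ∀ ω, 0 ≤ g ω := fun ω =>
    mul_nonneg (drift_nonneg _ _) (sub_nonneg.2 (escape_le_one _ _))
  -- Otherwise drift times escape integrates to 0; since escape is positive, the drift vanishes
  -- a.e., and then so does the integral of `g`.
  have hlt : ∫⁻ ω, ENNReal.ofReal (g ω) ∂μ < 1 := by
    by_contra! hge
    have hsplit : ∫⁻ ω, ENNReal.ofReal (drift ω 0) ∂μ = ∫⁻ ω, ENNReal.ofReal (g ω) ∂μ +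
        ∫⁻ ω, ENNReal.ofReal (drift ω 0 * escape ω 0) ∂μ := by
      rw [← lintegral_add_left hgm.ennreal_ofReal]
      refine lintegral_congr fun ω => ?_
      rw [← ENNReal.ofReal_add (hg0 ω) (mul_nonneg (drift_nonneg _ _) (escape_nonneg _ _)), hg]
      congr 1; ring
    have hz : ∫⁻ ω, ENNReal.ofReal (drift ω 0 * escape ω 0) ∂μ = 0 := by
      have h1 : 1 + ∫⁻ ω, ENNReal.ofReal (drift ω 0 * escape ω 0) ∂μ ≤ 1 + 0 := by
        rw [add_zero]
        refine le_trans ?_ hδ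
        rw [hsplit]
        gcongr
      exact nonpos_iff_eq_zero.1 ((ENNReal.add_le_add_iff_left ENNReal.one_ne_top).1 h1)
    have hm : Measurable fun ω => drift ω 0 * escape ω 0 :=
      (measurable_drift 0).mul (measurable_escape 0)
    rw [lintegral_eq_zero_iff hm.ennreal_ofReal] at hz
    have hg_zero : ∫⁻ ω, ENNReal.ofReal (g ω) ∂μ = 0 := by
      rw [lintegral_eq_zero_iff hgm.ennreal_ofReal]
      filter_upwards [hz, hpos] with ω h1 h2
      have h3 : drift ω 0 * escape ω 0 ≤ 0 := ENNReal.ofReal_eq_zero.1 h1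
      have h4 : drift ω 0 = 0 := le_antisymm (by nlinarith [drift_nonneg ω 0]) (drift_nonneg ω 0)
      simp [hg, h4]
    rw [hg_zero] at hge
    simp at hge
  obtain ⟨ω, ⟨c, hc, hc0, hf⟩, hω⟩ := ((frequently_sum_le_of_lintegral_lt_one
    hμ.toMeasurePreserving hgm hg0 hlt).and_eventually hpos).exists
  refine not_frequently_sum_le hω hc hc0 ?_
  simpa only [hg, drift_shift_iterate, escape_shift_iterate, zero_add] using hf

/-- If the mean drift per site exceeds one, the walk escapes with positive probability. -/
theorem ae_escape_pos (hμ : Ergodic shift μ)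
    (h : 2 < ∫⁻ ω, ENNReal.ofReal ((ω 0 : ℝ) / (1 - (ω 0 : ℝ))) ∂μ) :
    ∀ᵐ ω ∂μ, 0 < escape ω 0 := by
  refine (ae_escape_dichotomy hμ).resolve_left fun hzero => ?_
  have hδ : 1 < ∫⁻ ω, ENNReal.ofReal (drift ω 0) ∂μ := by
    rw [lintegral_ratio_eq] at h
    exact (ENNReal.add_lt_add_iff_right ENNReal.one_ne_top).1
      (one_add_one_eq_two.trans_lt h)
  set g : ℕ → Environment → ℝ := fun M ω => min (drift ω 0) M * (1 - cross ω 0 M) with hg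
  have hgm : ∀ M, Measurable (g M) := fun M =>
    ((measurable_drift 0).min measurable_const).mul (measurable_const.sub (measurable_cross 0 M))
  have hmin : ∀ (M : ℕ) ω, 0 ≤ min (drift ω 0) (M : ℝ) := fun M ω =>
    le_min (drift_nonneg _ _) M.cast_nonneg
  have hg0 : ∀ M ω, 0 ≤ g M ω := fun M ω =>
    mul_nonneg (hmin M ω) (sub_nonneg.2 (cross_le_one _ _ _))
  have hgM : ∀ M ω, g M ω ≤ M := fun M ω =>
    (mul_le_of_le_one_right (hmin M ω) (by linarith [cross_nonneg ω 0 M])).trans (min_le_right _ _)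
  -- Both factors increase with `M`, and 1 - cross tends to 1 because escape is zero a.e.; monotone
  -- convergence gives a single `M` with integral above 1.
  have hlim := lintegral_tendsto_of_tendsto_of_monotone (μ := μ)
    (f := fun M ω => ENNReal.ofReal (g M ω)) (F := fun ω => ENNReal.ofReal (drift ω 0))
    (fun M => (hgm M).ennreal_ofReal.aemeasurable)
    (ae_of_all _ fun ω M N hMN => ENNReal.ofReal_le_ofReal (by
      have h1 : (M : ℝ) ≤ N := by exact_mod_cast hMN
      have h2 := antitone_cross ω hMN
      have h3 := hmin M ω
      have h4 := hmin N ω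
      have h5 := cross_le_one ω 0 M
      exact mul_le_mul (min_le_min_left _ h1) (by dsimp only at h2; linarith) (by linarith) h4))
    (by
      filter_upwards [hzero] with ω hω
      refine (ENNReal.continuous_ofReal.tendsto _).comp ?_
      have h1 : Tendsto (fun M : ℕ => min (drift ω 0) (M : ℝ)) atTop (𝓝 (drift ω 0)) := by
        refine tendsto_const_nhds.congr' ?_
        filter_upwards [tendsto_natCast_atTop_atTop.eventually_ge_atTop (drift ω 0)] with M hM
        exact (min_eq_left hM).symm
      have h2 := tendsto_cross ω
      rw [hω] at h2
      simpa [hg] using h1.mul ((tendsto_const_nhds (x := (1 : ℝ))).sub h2))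
  obtain ⟨M, hM⟩ := (hlim.eventually_const_lt hδ).exists
  obtain ⟨ω, c, hc, hf⟩ := (frequently_le_sum_of_one_lt_lintegral
    hμ.toMeasurePreserving (hgm M) (hg0 M) (hgM M) hM).exists
  refine not_frequently_le_sum (ω := ω) M hc ?_
  simpa only [hg, drift_shift_iterate, cross_shift_iterate, zero_add, add_comm (M : ℤ)] using hf

/-! ### Trajectories -/

section Trajectories

variable {n : ℕ}

/-- Append a position to a history. -/
def snocHistory (h : Finset.Iic n → ℤ) (y : ℤ) : Finset.Iic (n + 1) → ℤ :=
  fun i => if hi : (i : ℕ) ≤ n then h ⟨i, Finset.mem_Iic.2 hi⟩ else y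

lemma current_snocHistory (h : Finset.Iic n → ℤ) (y : ℤ) : current (snocHistory h y) = y := by
  simp [current, snocHistory]

lemma consumed_snocHistory (h : Finset.Iic n → ℤ) (y x : ℤ) :
    Consumed (snocHistory h y) x ↔ Consumed h x ∨ (current h = x ∧ y = x - 1) := by
  constructor
  · rintro ⟨k, hk, h1, h2⟩
    rcases (Nat.lt_succ_iff.1 hk).lt_or_eq with hlt | rfl
    · left
      refine ⟨k, hlt, ?_, ?_⟩
      · simpa [snocHistory, hlt.le] using h1
      · simpa [snocHistory, Nat.succ_le_of_lt hlt] using h2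
    · right
      refine ⟨?_, ?_⟩
      · simpa [snocHistory, current] using h1
      · simpa [snocHistory] using h2
  · rintro (⟨k, hk, h1, h2⟩ | ⟨h1, h2⟩)
    · refine ⟨k, hk.trans n.lt_succ_self, ?_, ?_⟩
      · simpa [snocHistory, hk.le] using h1
      · simpa [snocHistory, Nat.succ_le_of_lt hk] using h2
    · refine ⟨n, n.lt_succ_self, ?_, ?_⟩
      · simpa [snocHistory, current] using h1
      · simpa [snocHistory] using h2

/-- The set of sites whose cookie has been consumed. -/
def consumedSet (h : Finset.Iic n → ℤ) : Set ℤ := {x | Consumed h x}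

lemma consumedSet_snocHistory_right (h : Finset.Iic n → ℤ) :
    consumedSet (snocHistory h (current h + 1)) = consumedSet h := by
  ext x
  refine (consumed_snocHistory h _ x).trans (or_iff_left ?_)
  omega

lemma consumedSet_snocHistory_left (h : Finset.Iic n → ℤ) :
    consumedSet (snocHistory h (current h - 1)) = insert (current h) (consumedSet h) := by
  ext x
  refine (consumed_snocHistory h _ x).trans ?_
  rw [Set.mem_insert_iff, or_comm]
  refine or_congr_left ?_
  omega

lemma finite_consumedSet (h : Finset.Iic n → ℤ) : (consumedSet h).Finite := by
  refine (Set.finite_range h).subset ?_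
  rintro x ⟨k, hk, h1, -⟩
  exact ⟨_, h1⟩

lemma rightProb_eq_rightWeight (ω : Environment) (h : Finset.Iic n → ℤ) :
    rightProb ω h = rightWeight ω (consumedSet h) (current h) := rfl

/-- The law of the walk conditioned on the history `h`. -/
noncomputable abbrev lawFrom (ω : Environment) (h : Finset.Iic n → ℤ) : Measure (ℕ → ℤ) :=
  Kernel.traj (X := fun _ => ℤ) (stepKernel ω) n h

/-- The one-step Markov property, which matches the recursion defining `stoppedExp`. -/
lemma lawFrom_succ (ω : Environment) (h : Finset.Iic n → ℤ) {E : Set (ℕ → ℤ)}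
    (hE : MeasurableSet E) :
    lawFrom ω h E =
      ENNReal.ofReal (rightProb ω h) * lawFrom ω (snocHistory h (current h + 1)) E +
      ENNReal.ofReal (1 - rightProb ω h) * lawFrom ω (snocHistory h (current h - 1)) E := by
  have hsnoc : ∀ y : ℤ, IicProdIoc (X := fun _ => ℤ) n (n + 1)
      (h, MeasurableEquiv.piSingleton (X := fun _ => ℤ) n y) = snocHistory h y := by
    intro y
    funext i
    by_cases hi : (i : ℕ) ≤ n
    · simp [IicProdIoc_def, snocHistory, hi]
    · have : (i : ℕ) = n + 1 := by have := Finset.mem_Iic.1 i.2; omega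
      simp [IicProdIoc_def, snocHistory, hi, MeasurableEquiv.piSingleton]
  have hm : Measurable fun h' : Finset.Iic (n + 1) → ℤ => lawFrom ω h' E :=
    Kernel.measurable_coe _ hE
  unfold lawFrom
  rw [← Kernel.traj_comp_partialTraj (X := fun _ => ℤ) (κ := stepKernel ω) n.le_succ,
    Kernel.comp_apply' _ _ _ hE, Kernel.partialTraj_succ_self, Kernel.map_apply _ (by fun_prop),
    lintegral_map hm (by fun_prop), Kernel.lintegral_id_prod, Kernel.map_apply _ (by fun_prop),
    lintegral_map]
  · simp only [hsnoc]
    change ∫⁻ y, _ ∂(stepMeasure ω h) = _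
    rw [stepMeasure, lintegral_add_measure, lintegral_smul_measure, lintegral_smul_measure,
      lintegral_dirac, lintegral_dirac]
    rfl
  all_goals fun_prop

lemma lawFrom_ae_eq (ω : Environment) (h : Finset.Iic n → ℤ) :
    ∀ᵐ X ∂(lawFrom ω h), Preorder.frestrictLe (π := fun _ => ℤ) n X = h := by
  have h1 := Kernel.traj_map_frestrictLe_of_le (X := fun _ => ℤ) (κ := stepKernel ω) (le_refl n)
  have h2 := congrArg (fun k => k h) h1
  rw [Kernel.map_apply _ (by fun_prop), Kernel.deterministic_apply] at h2
  refine ae_of_ae_map (p := fun g => g = h) (by fun_prop) ?_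
  rw [h2, ae_dirac_eq]
  rfl

lemma lawFrom_ae_apply (ω : Environment) (h : Finset.Iic n → ℤ) :
    ∀ᵐ X ∂(lawFrom ω h), X n = current h :=
  (lawFrom_ae_eq ω h).mono fun X hX => by rw [← hX]; rfl

lemma measurable_eval (n : ℕ) : Measurable fun X : ℕ → ℤ => X n := measurable_pi_apply n

lemma measurableSet_avoid (x : ℤ) (n m : ℕ) :
    MeasurableSet {X : ℕ → ℤ | ∀ j ≤ m, X (n + j) ≠ x} := by
  have : {X : ℕ → ℤ | ∀ j ≤ m, X (n + j) ≠ x} = ⋂ j ≤ m, {X | X (n + j) ≠ x} := by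
    ext X; simp
  rw [this]
  exact MeasurableSet.iInter fun j => MeasurableSet.iInter fun _ =>
    measurable_eval (n + j) (measurableSet_singleton x).compl

/-- The chain on pairs (position, set of consumed cookies) describes the walk. -/
lemma lawFrom_avoid (ω : Environment) (x : ℤ) (m : ℕ) :
    ∀ {n : ℕ} (h : Finset.Iic n → ℤ), lawFrom ω h {X | ∀ j ≤ m, X (n + j) ≠ x} =
      ENNReal.ofReal (avoid ω x m (current h) (consumedSet h)) := by
  induction m with
  | zero =>
    intro n h
    by_cases hx : current h = x
    · rw [hx, avoid_self, ENNReal.ofReal_zero]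
      refine measure_eq_zero_iff_ae_notMem.2 ?_
      filter_upwards [lawFrom_ae_apply ω h] with X hX hX'
      exact hX' 0 le_rfl (hX.trans hx)
    · rw [avoid_zero hx, ENNReal.ofReal_one]
      refine (mem_ae_iff_prob_eq_one (measurableSet_avoid x n 0)).1 ?_
      filter_upwards [lawFrom_ae_apply ω h] with X hX j hj
      rw [Nat.le_zero.1 hj, add_zero, hX]
      exact hx
  | succ m ih =>
    intro n h
    by_cases hx : current h = x
    · rw [hx, avoid_self, ENNReal.ofReal_zero]
      refine measure_eq_zero_iff_ae_notMem.2 ?_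
      filter_upwards [lawFrom_ae_apply ω h] with X hX hX'
      exact hX' 0 (Nat.zero_le _) (hX.trans hx)
    · have h1 : lawFrom ω h {X | ∀ j ≤ m + 1, X (n + j) ≠ x} =
          lawFrom ω h {X | ∀ j ≤ m, X (n + 1 + j) ≠ x} := by
        refine measure_congr ?_
        filter_upwards [lawFrom_ae_apply ω h] with X hX
        refine propext ⟨fun H j hj => ?_, fun H j hj => ?_⟩
        · rw [add_assoc, add_comm 1 j]
          exact H (j + 1) (by omega)
        · cases j with
          | zero => rw [add_zero, hX]; exact hx
          | succ j =>
            rw [add_comm j 1, ← add_assoc]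
            exact H j (by omega)
      have hp := rightProb_mem ω h
      rw [h1, lawFrom_succ ω h (measurableSet_avoid x (n + 1) m), ih, ih, current_snocHistory,
        current_snocHistory, consumedSet_snocHistory_left, consumedSet_snocHistory_right,
        avoid_succ hx, ← rightProb_eq_rightWeight,
        ENNReal.ofReal_add (mul_nonneg hp.1 (avoid_nonneg _ _ _ _ _))
          (mul_nonneg (sub_nonneg.2 hp.2) (avoid_nonneg _ _ _ _ _)),
        ENNReal.ofReal_mul hp.1, ENNReal.ofReal_mul (sub_nonneg.2 hp.2)]

lemma lawFrom_avoidForever (ω : Environment) (x : ℤ) (h : Finset.Iic n → ℤ) :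
    lawFrom ω h {X | ∀ j, X (n + j) ≠ x} =
      ENNReal.ofReal (avoidForever ω x (current h) (consumedSet h)) := by
  have heq : {X : ℕ → ℤ | ∀ j, X (n + j) ≠ x} = ⋂ m, {X | ∀ j ≤ m, X (n + j) ≠ x} := by
    ext X
    simp only [Set.mem_iInter]
    exact ⟨fun H m j _ => H j, fun H j => H j j le_rfl⟩
  have h1 := tendsto_measure_iInter_atTop (μ := lawFrom ω h)
    (fun m => (measurableSet_avoid x n m).nullMeasurableSet)
    (fun a b hab X hX j hj => hX j (hj.trans hab)) ⟨0, measure_ne_top _ _⟩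
  rw [← heq] at h1
  refine tendsto_nhds_unique h1 ?_
  simp only [Function.comp_def, lawFrom_avoid]
  exact (ENNReal.continuous_ofReal.tendsto _).comp (tendsto_avoid ω x _ _)

lemma measurableSet_avoidForever (x : ℤ) (n : ℕ) :
    MeasurableSet {X : ℕ → ℤ | ∀ j, X (n + j) ≠ x} := by
  rw [Set.ofPred_forall]
  exact MeasurableSet.iInter fun j =>
    measurable_eval (n + j) (measurableSet_singleton x).compl

lemma measurableSet_frequently (x : ℤ) : MeasurableSet {X : ℕ → ℤ | ∃ᶠ n in atTop, X n = x} := by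
  have : {X : ℕ → ℤ | ∃ᶠ n in atTop, X n = x} = ⋂ n, {X | ∀ j, X (n + j) ≠ x}ᶜ := by
    ext X
    simp only [Set.mem_iInter, Set.mem_compl_iff, Set.mem_ofPred_eq, frequently_atTop, not_forall,
      not_not]
    refine forall_congr' fun n => ⟨?_, ?_⟩
    · rintro ⟨b, hb, h⟩; exact ⟨b - n, by rwa [Nat.add_sub_cancel' hb]⟩
    · rintro ⟨j, h⟩; exact ⟨n + j, Nat.le_add_right _ _, h⟩
  rw [this]
  exact MeasurableSet.iInter fun n => (measurableSet_avoidForever x n).compl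

lemma quenchedLaw_eq_zero_of_lawFrom (ω : Environment) (y : ℤ) (n : ℕ) {E : Set (ℕ → ℤ)}
    (hE : MeasurableSet E) (h : ∀ g : Finset.Iic n → ℤ, lawFrom ω g E = 0) :
    quenchedLaw ω y E = 0 := by
  rw [quenchedLaw, ← Kernel.traj_comp_partialTraj (X := fun _ => ℤ) (κ := stepKernel ω) n.zero_le,
    Kernel.comp_apply' _ _ _ hE]
  simp only [h, lintegral_zero]

lemma quenchedLaw_ae_step (ω : Environment) (y : ℤ) :
    ∀ᵐ X ∂(quenchedLaw ω y), ∀ n, X (n + 1) = X n + 1 ∨ X (n + 1) = X n - 1 := by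
  rw [ae_all_iff]
  intro n
  have hm : MeasurableSet {X : ℕ → ℤ | X (n + 1) = X n + 1 ∨ X (n + 1) = X n - 1} := by
    have hf : Measurable fun X : ℕ → ℤ => (X (n + 1), X n) := by fun_prop
    exact hf (MeasurableSet.of_discrete (s := {p : ℤ × ℤ | p.1 = p.2 + 1 ∨ p.1 = p.2 - 1}))
  refine quenchedLaw_eq_zero_of_lawFrom ω y n hm.compl fun g => ?_
  have key : ∀ z, (z = current g + 1 ∨ z = current g - 1) → lawFrom ω (snocHistory g z)
      {X : ℕ → ℤ | X (n + 1) = X n + 1 ∨ X (n + 1) = X n - 1}ᶜ = 0 := by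
    intro z hz
    refine measure_eq_zero_iff_ae_notMem.2 ?_
    filter_upwards [lawFrom_ae_eq ω (snocHistory g z)] with X hX
    have h1 : X (n + 1) = z := by
      have := congrFun hX ⟨n + 1, Finset.mem_Iic.2 le_rfl⟩
      simpa [snocHistory] using this
    have h2 : X n = current g := by
      have := congrFun hX ⟨n, Finset.mem_Iic.2 n.le_succ⟩
      simpa [snocHistory, current] using this
    simpa [h1, h2, or_iff_not_imp_left] using hz
  rw [lawFrom_succ ω g hm.compl, key _ (Or.inl rfl), key _ (Or.inr rfl)]
  simp

instance (ω : Environment) (y : ℤ) : IsProbabilityMeasure (quenchedLaw ω y) := by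
  unfold quenchedLaw; infer_instance

end Trajectories

/-! ### From escape probabilities to recurrence and transience -/

/-- If escape is impossible from every site, the walk is recurrent. -/
theorem recurrent_of_escape_eq_zero {ω : Environment} (h : ∀ x, escape ω x = 0) :
    Recurrent ω := by
  intro x y
  refine (mem_ae_iff_prob_eq_one (measurableSet_frequently x)).1 ?_
  have hall : ∀ᵐ X ∂(quenchedLaw ω y), ∀ n, ¬ ∀ j, X (n + j) ≠ x := by
    rw [ae_all_iff]
    intro n
    refine (measure_eq_zero_iff_ae_notMem (s := {X : ℕ → ℤ | ∀ j, X (n + j) ≠ x})).1 ?_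
    refine quenchedLaw_eq_zero_of_lawFrom ω y n (measurableSet_avoidForever x n) fun g => ?_
    rw [lawFrom_avoidForever, avoidForever_eq_zero h x _ (finite_consumedSet g),
      ENNReal.ofReal_zero]
  filter_upwards [hall] with X hX
  refine frequently_atTop.2 fun n => ?_
  obtain ⟨j, hj⟩ := not_forall.1 (hX n)
  exact ⟨n + j, Nat.le_add_right _ _, not_not.1 hj⟩

lemma condExp_indicator_quenchedLaw (ω : Environment) (y : ℤ) (n : ℕ) {B : Set (ℕ → ℤ)}
    (hB : MeasurableSet B) :
    (quenchedLaw ω y)[B.indicator fun _ => (1 : ℝ) | Filtration.piLE (X := fun _ : ℕ => ℤ) n]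
      =ᵐ[quenchedLaw ω y]
      fun X => (lawFrom ω (Preorder.frestrictLe (π := fun _ => ℤ) n X)).real B := by
  have hint : Integrable (B.indicator fun _ => (1 : ℝ)) (quenchedLaw ω y) :=
    (integrable_const 1).indicator hB
  refine (Kernel.condExp_traj (X := fun _ => ℤ) (κ := stepKernel ω) (a := 0) (b := n) n.zero_le
    (x₀ := fun _ => y) (f := B.indicator fun _ => (1 : ℝ)) hint).trans (Eventually.of_forall ?_)
  intro X
  refine (integral_indicator_const (1 : ℝ) hB).trans ?_
  rw [smul_eq_mul, mul_one]

lemma quenchedLaw_ae_hit (ω : Environment) {x y : ℤ} (hxy : y ≤ x) :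
    ∀ᵐ X ∂(quenchedLaw ω y), ∃ n, X n = x := by
  have h := lawFrom_avoidForever ω x (n := 0) (fun _ => y)
  rw [show current (n := 0) (fun _ => y) = y from rfl, avoidForever_eq_zero_of_le hxy,
    ENNReal.ofReal_zero, measure_eq_zero_iff_ae_notMem] at h
  filter_upwards [h] with X hX
  simp only [not_forall, not_not, zero_add] at hX
  exact hX

/-- A nearest-neighbour path arrives at a new maximum without having used cookies there or
further to the right. -/
lemma consumedSet_first_hit {X : ℕ → ℤ} (hX : ∀ n, X (n + 1) = X n + 1 ∨ X (n + 1) = X n - 1)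
    {x : ℤ} (h0 : X 0 < x) {n : ℕ} (hn : ∀ m < n, X m ≠ x) :
    ∀ y, x ≤ y → y ∉ consumedSet (Preorder.frestrictLe (π := fun _ => ℤ) n X) := by
  have hlt : ∀ m < n, X m < x := by
    intro m hm
    induction m with
    | zero => exact h0
    | succ m ih =>
      have h1 := ih (by omega)
      have h2 := hn _ hm
      have h3 := hX m
      omega
  rintro y hy ⟨k, hk, h1, -⟩
  have h2 : X k = y := h1
  have := hlt k hk
  omega

/-- If escape has uniformly positive probability from infinitely many sites to the right, the walk
is transient. -/
theorem transient_of_frequently_le_escape {ω : Environment} {ε : ℝ} (hε : 0 < ε)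
    (h : ∃ᶠ n : ℕ in atTop, ε ≤ escape ω n) : Transient ω := by
  intro x y
  set B : Set (ℕ → ℤ) := {X | ∃ᶠ n in atTop, X n = x} with hB
  have hBm : MeasurableSet B := measurableSet_frequently x
  have hint : Integrable (B.indicator fun _ => (1 : ℝ)) (quenchedLaw ω y) :=
    (integrable_const 1).indicator hBm
  have hlevy := hint.tendsto_ae_condExp (ℱ := Filtration.piLE (X := fun _ : ℕ => ℤ)) (by
    -- The positions generate the whole σ-algebra, so the Lévy limit is the indicator of `B` itself.
    have hsup : (⨆ n, Filtration.piLE (X := fun _ : ℕ => ℤ) n) = MeasurableSpace.pi := by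
      refine le_antisymm (iSup_le fun n => Filtration.piLE.le n) (iSup_le fun n => ?_)
      refine le_trans ?_ (le_iSup _ n)
      rw [Filtration.piLE_eq_comap_frestrictLe]
      rintro _ ⟨s, hs, rfl⟩
      exact ⟨_, measurable_pi_apply (⟨n, Finset.mem_Iic.2 le_rfl⟩ : Finset.Iic n) hs, rfl⟩
    rw [hsup]
    exact stronglyMeasurable_const.indicator hBm)
  have hcond : ∀ᵐ X ∂(quenchedLaw ω y), ∀ n,
      ((quenchedLaw ω y)[B.indicator fun _ => (1 : ℝ) | Filtration.piLE (X := fun _ : ℕ => ℤ) n]) X =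
        (lawFrom ω (Preorder.frestrictLe (π := fun _ => ℤ) n X)).real B :=
    ae_all_iff.2 fun n => condExp_indicator_quenchedLaw ω y n hBm
  have hhit : ∀ᵐ X ∂(quenchedLaw ω y), ∀ z, y ≤ z → ∃ n, X n = z := by
    rw [ae_all_iff]
    intro z
    by_cases hz : y ≤ z
    · simpa [hz] using quenchedLaw_ae_hit ω hz
    · simp [hz]
  have hstart : ∀ᵐ X ∂(quenchedLaw ω y), X 0 = y := lawFrom_ae_apply ω (n := 0) fun _ => y
  rw [measure_eq_zero_iff_ae_notMem]
  filter_upwards [hlevy, hcond, hhit, hstart, quenchedLaw_ae_step ω y] with X h1 h2 h3 h4 h5 hXB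
  rw [Set.indicator_of_mem hXB] at h1
  simp only [h2] at h1
  have hlarge := h1.eventually_const_lt (show 1 - ε < 1 by linarith)
  obtain ⟨N, hN⟩ := eventually_atTop.1 hlarge
  -- A site `z ≥ K` cannot be visited before time `N`, so its first hitting time falls where the
  -- conditional probability of `B` already exceeds `1 - ε`.
  have hbound : ∃ K : ℤ, ∀ m < N, X m < K := by
    obtain ⟨K, hK⟩ := ((Finset.range N).image X).bddAbove
    exact ⟨K + 1, fun m hm => Int.lt_add_one_iff.2 (hK (Finset.mem_coe.2
      (Finset.mem_image_of_mem X (Finset.mem_range.2 hm))))⟩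
  obtain ⟨K, hK⟩ := hbound
  obtain ⟨z, hz1, hz2⟩ := (h.and_eventually
    (eventually_ge_atTop (max K (max (x + 1) (y + 1))).toNat)).exists
  have hzK : K ≤ z := by omega
  have hzx : x < z := by omega
  have hzy : y < z := by omega
  classical
  have hex := h3 z hzy.le
  set n := Nat.find hex with hn
  have hXn : X n = z := Nat.find_spec hex
  have hnN : N ≤ n := by
    by_contra! hlt
    have := hK n hlt
    omega
  set g := Preorder.frestrictLe (π := fun _ => ℤ) n X with hg
  have hcur : current g = z := hXn
  have hC : ∀ y, (z : ℤ) ≤ y → y ∉ consumedSet g :=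
    consumedSet_first_hit h5 (by omega) fun m hm => Nat.find_min hex hm
  -- No cookie at or beyond `z` is consumed at the first visit, and avoiding `z - 1` entails
  -- avoiding `x`, since `x ≤ z - 1`.
  have hesc : escape ω z ≤ avoidForever ω x z (consumedSet g) := by
    rw [escape, ← avoidForever_congr_consumed (C := consumedSet g) (by omega)
      (fun y hy => by simp [hC y (by omega)])]
    exact avoidForever_mono_target (by omega) (by omega)
  have hdisj : (lawFrom ω g).real B ≤ 1 - ε := by
    have h6 : B ⊆ {X | ∀ j, X (n + j) ≠ x}ᶜ := by
      intro X' hX' hav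
      obtain ⟨b, hb, hb'⟩ := frequently_atTop.1 hX' n
      exact hav (b - n) (by rwa [Nat.add_sub_cancel' hb])
    refine (measureReal_mono h6).trans ?_
    rw [probReal_compl_eq_one_sub (measurableSet_avoidForever x n), measureReal_def,
      lawFrom_avoidForever, hcur, ENNReal.toReal_ofReal (avoidForever_nonneg _ _ _ _)]
    linarith
  exact absurd (hN n hnN) (not_lt.2 hdisj)

theorem ae_transient_of_escape_pos {μ : Measure Environment} [IsProbabilityMeasure μ]
    (hμ : MeasurePreserving shift μ μ) (h : ∀ᵐ ω ∂μ, 0 < escape ω 0) : ∀ᵐ ω ∂μ, Transient ω := by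
  -- Poincaré recurrence, for countably many thresholds so that one null set serves them all.
  have hrec : ∀ᵐ ω ∂μ, ∀ m : ℕ, 1 / ((m : ℝ) + 1) ≤ escape ω 0 →
      ∃ᶠ n in atTop, 1 / ((m : ℝ) + 1) ≤ escape (shift^[n] ω) 0 := by
    rw [ae_all_iff]
    intro m
    exact hμ.conservative.ae_mem_imp_frequently_image_mem
      (s := {ω | 1 / ((m : ℝ) + 1) ≤ escape ω 0})
      (measurableSet_le measurable_const (measurable_escape 0)).nullMeasurableSet
  filter_upwards [h, hrec] with ω h1 h2
  obtain ⟨m, hm⟩ := exists_nat_one_div_lt h1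
  refine transient_of_frequently_le_escape (ε := 1 / ((m : ℝ) + 1)) (by positivity) ?_
  simpa only [escape_shift_iterate, zero_add] using h2 m hm.le

end CookieWalk

theorem theorem2 (μ : Measure CookieWalk.Environment) [IsProbabilityMeasure μ]
    (hμ : Ergodic CookieWalk.shift μ) :
    (∫⁻ ω, ENNReal.ofReal ((ω 0 : ℝ) / (1 - (ω 0 : ℝ))) ∂μ ≤ 2 →
      ∀ᵐ ω ∂μ, CookieWalk.Recurrent ω) ∧
    (2 < ∫⁻ ω, ENNReal.ofReal ((ω 0 : ℝ) / (1 - (ω 0 : ℝ))) ∂μ →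
      ∀ᵐ ω ∂μ, CookieWalk.Transient ω) :=
  ⟨fun h => (CookieWalk.ae_escape_eq_zero hμ h).mono fun _ =>
      CookieWalk.recurrent_of_escape_eq_zero,
    fun h => CookieWalk.ae_transient_of_escape_pos hμ.toMeasurePreserving
      (CookieWalk.ae_escape_pos hμ h)⟩
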